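/- Let $X$ and $Y$ be connected finite graphs, i.e. connected Hausdorff spaces that admit the structure of a finite CW complex of dimension at most $1$; assume that $Y$ has more than one point and is not homeomorphic to the circle. Write $\mathrm{Coin}(f,g)=\{x\in X : f(x)=g(x)\}$ for continuous maps $f,g:X\to Y$. (1) For all continuous maps $f,g:X\to Y$ there are continuous maps $f',g':X\to Y$ with $f\simeq f'$, $g\simeq g'$ and $\mathrm{Coin}(f',g')=\emptyset$. Consequently, every homotopy-invariant coincidence index, Nielsen coincidence number and coincidence Reidemeister trace for maps $X\to Y$ vanishes: (2) Let $A$ be an abelian group, and let $\mathrm{ind}(f,g)\in A$ be defined for all continuous $f,g:X\to Y$, depend only on the homotopy classes of $f$ and $g$, and be $0$ whenever $\mathrm{Coin}(f,g)=\emptyset$. Then $\mathrm{ind}(f,g)=0$ for all $f,g$. (3) Let $N(f,g)\in\mathbb{N}$ be defined for all continuous $f,g:X\to Y$, depend only on the homotopy classes of $f$ and $g$, and satisfy $N(f,g)\le\#\mathrm{Coin}(f,g)$. Then $N(f,g)=0$ for all $f,g$. (4) Let $\mathcal{R}(f,g)$ be the set of Reidemeister classes of $(f,g)$: classes of pairs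 $(x,\alpha)$, with $x\in X$ and $\alpha$ a homotopy class (relative to the end points) of paths from $f(x)$ to $g(x)$, where $(x,\alpha)\sim(y,\beta)$ if $\alpha\cdot g(c)=f(c)\cdot\beta$ for some path $c$ from $x$ to $y$. Homotopies $F:f\simeq f'$ and $G:g\simeq g'$ induce a map $\mathcal{R}(f,g)\to\mathcal{R}(f',g')$, $[(x,\alpha)]\mapsto[(x,F(x)^{-1}\cdot\alpha\cdot G(x))]$, where $F(x)$ and $G(x)$ are the paths traced by $x$. Let $A$ be an abelian group, and let $RT(f,g)$ be, for all continuous $f,g:X\to Y$, a finite formal sum of elements of $\mathcal{R}(f,g)$ with coefficients in $A$, such that the map induced by any such pair of homotopies carries $RT(f,g)$ to $RT(f',g')$, and $RT(f,g)=0$ whenever $\mathrm{Coin}(f,g)=\emptyset$. Then $RT(f,g)=0$ for all $f,g$; in particular the number of classes with a nonzero coefficient in $RT(f,g)$ is $0$. -/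

import Mathlib

open Topology

universe u v w

/-- A (possibly degenerate) finite graph: a Hausdorff space that carries the structure of a CW
complex with finitely many cells, all of them of dimension `0` or `1`.  For a connected space,
having at least two points then means that there is at least one edge. -/
class IsFiniteGraph (X : Type*) [TopologicalSpace X] : Prop where
  t2Space : T2Space X
  exists_cwComplex : ∃ _ : CWComplex (Set.univ : Set X),
    RelCWComplex.Finite (Set.univ : Set X) ∧
      ∀ n : ℕ, 2 ≤ n → IsEmpty (RelCWComplex.cell (Set.univ : Set X) n)

section Coincidence

variable {X Y : Type*} [TopologicalSpace X] [TopologicalSpace Y]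

/-- The coincidence set `Coin(f, g) = {x | f x = g x}`. -/
def coin (f g : C(X, Y)) : Set X := {x | f x = g x}

/-- Two pairs `(x, α)`, `(y, β)`, where `α` is a homotopy class of paths from `f x` to `g x` and
`β` one from `f y` to `g y`, are equivalent if some path `c` from `x` to `y` satisfies
`α * g(c) = f(c) * β` up to homotopy relative to the end points. -/
def reidemeisterSetoid (f g : C(X, Y)) :
    Setoid (Σ x : X, Path.Homotopic.Quotient (f x) (g x)) where
  r a b := ∃ c : Path.Homotopic.Quotient a.1 b.1, a.2.trans (c.map g) = (c.map f).trans b.2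
  iseqv := by
    refine ⟨?_, ?_, ?_⟩
    · rintro ⟨x, α⟩
      refine ⟨Path.Homotopic.Quotient.refl x, ?_⟩
      have h : ∀ k : C(X, Y), (Path.Homotopic.Quotient.refl x).map k =
          Path.Homotopic.Quotient.refl (k x) := fun k => rfl
      rw [h, h, Path.Homotopic.Quotient.trans_refl, Path.Homotopic.Quotient.refl_trans]
    · rintro ⟨x, α⟩ ⟨y, β⟩ ⟨c, hc⟩
      refine ⟨c.symm, ?_⟩
      have h : ∀ k : C(X, Y), c.symm.map k = (c.map k).symm := by
        intro k
        induction c using Path.Homotopic.Quotient.ind with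
        | mk c => rfl
      dsimp only at hc ⊢
      rw [h, h]
      calc β.trans (c.map g).symm
          = ((c.map f).symm.trans ((c.map f).trans β)).trans (c.map g).symm := by
            rw [← Path.Homotopic.Quotient.trans_assoc (c.map f).symm,
              Path.Homotopic.Quotient.symm_trans, Path.Homotopic.Quotient.refl_trans]
        _ = (c.map f).symm.trans α := by
            rw [← hc, Path.Homotopic.Quotient.trans_assoc, Path.Homotopic.Quotient.trans_assoc,
              Path.Homotopic.Quotient.trans_symm, Path.Homotopic.Quotient.trans_refl]
    · rintro ⟨x, α⟩ ⟨y, β⟩ ⟨z, γ⟩ ⟨c, hc⟩ ⟨d, hd⟩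
      refine ⟨c.trans d, ?_⟩
      have h : ∀ k : C(X, Y), (c.trans d).map k = (c.map k).trans (d.map k) := by
        intro k
        induction c using Path.Homotopic.Quotient.ind with
        | mk c =>
          induction d using Path.Homotopic.Quotient.ind with
          | mk d =>
            rw [← Path.Homotopic.Quotient.mk_trans, ← Path.Homotopic.Quotient.mk_map,
              Path.map_trans, Path.Homotopic.Quotient.mk_trans]
            rfl
      dsimp only at hc hd ⊢
      rw [h, h, ← Path.Homotopic.Quotient.trans_assoc, hc, Path.Homotopic.Quotient.trans_assoc, hd,
        Path.Homotopic.Quotient.trans_assoc]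

/-- The set `R(f, g)` of Reidemeister classes of the pair `(f, g)`.  For path connected `X` and
`Y`, a choice of a base point `x₀` and of a path from `f x₀` to `g x₀` identifies it with the set
of doubly twisted conjugacy classes in `π₁(Y)`. -/
def ReidemeisterClass (f g : C(X, Y)) : Type _ :=
  Quotient (reidemeisterSetoid f g)

/-- The map `R(f, g) → R(f', g')` induced by a pair of homotopies `F : f ≃ f'` and `G : g ≃ g'`,
sending the class of `(x, α)` to that of `(x, F(x)⁻¹ * α * G(x))`, where `F(x)` is the path
`t ↦ F (t, x)`. -/
noncomputable def ReidemeisterClass.transport {f f' g g' : C(X, Y)} (F : f.Homotopy f') (G : g.Homotopy g') :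
    ReidemeisterClass f g → ReidemeisterClass f' g' :=
  Quotient.map
    (fun a => ⟨a.1, (Path.Homotopic.Quotient.mk (F.evalAt a.1)).symm.trans
      (a.2.trans (Path.Homotopic.Quotient.mk (G.evalAt a.1)))⟩)
    (by
      rintro ⟨x, α⟩ ⟨y, β⟩ ⟨c, hc⟩
      refine ⟨c, ?_⟩
      have nat : ∀ {k k' : C(X, Y)} (K : k.Homotopy k'),
          (c.map k).trans (Path.Homotopic.Quotient.mk (K.evalAt y)) =
            (Path.Homotopic.Quotient.mk (K.evalAt x)).trans (c.map k') := by
        intro k k' K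
        induction c using Path.Homotopic.Quotient.ind with
        | mk c => exact Path.Homotopic.Quotient.eq.2 (Path.Homotopic.map_trans_evalAt K c)
      have nF := nat F
      have nG := nat G
      dsimp only at hc ⊢
      set φx := Path.Homotopic.Quotient.mk (F.evalAt x)
      set φy := Path.Homotopic.Quotient.mk (F.evalAt y)
      set γx := Path.Homotopic.Quotient.mk (G.evalAt x)
      set γy := Path.Homotopic.Quotient.mk (G.evalAt y)
      have e : φx.symm.trans (c.map f) = (c.map f').trans φy.symm := by
        calc φx.symm.trans (c.map f)
            = φx.symm.trans (((c.map f).trans φy).trans φy.symm) := by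
              rw [Path.Homotopic.Quotient.trans_assoc (c.map f),
                Path.Homotopic.Quotient.trans_symm, Path.Homotopic.Quotient.trans_refl]
          _ = (c.map f').trans φy.symm := by
              rw [nF, ← Path.Homotopic.Quotient.trans_assoc,
                ← Path.Homotopic.Quotient.trans_assoc, Path.Homotopic.Quotient.symm_trans,
                Path.Homotopic.Quotient.refl_trans]
      rw [Path.Homotopic.Quotient.trans_assoc, Path.Homotopic.Quotient.trans_assoc, ← nG,
        ← Path.Homotopic.Quotient.trans_assoc α, hc, Path.Homotopic.Quotient.trans_assoc,
        ← Path.Homotopic.Quotient.trans_assoc φx.symm, e, Path.Homotopic.Quotient.trans_assoc])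

variable (X Y)

/-- A homotopy-invariant coincidence index for maps `X → Y`, with values in an abelian group `A`:
an assignment which is invariant under homotopies of both maps and which is zero on
coincidence-free pairs. -/
structure CoincidenceIndex (A : Type*) [AddCommGroup A] where
  index : C(X, Y) → C(X, Y) → A
  homotopy_invariant : ∀ f f' g g' : C(X, Y), f.Homotopic f' → g.Homotopic g' →
    index f g = index f' g'
  eq_zero_of_coincidenceFree : ∀ f g : C(X, Y), coin f g = ∅ → index f g = 0

/-- A homotopy-invariant Nielsen coincidence number for maps `X → Y`: a natural number attached
to each pair of maps which is invariant under homotopies of both maps and which is a lower bound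
for the number of coincidence points. -/
structure NielsenCoincidenceNumber where
  number : C(X, Y) → C(X, Y) → ℕ
  homotopy_invariant : ∀ f f' g g' : C(X, Y), f.Homotopic f' → g.Homotopic g' →
    number f g = number f' g'
  le_encard_coin : ∀ f g : C(X, Y), (number f g : ℕ∞) ≤ (coin f g).encard

/-- A homotopy-invariant coincidence Reidemeister trace for maps `X → Y`, with coefficients in an
abelian group `A` (classically `ℤ`): a finite formal sum of Reidemeister classes of `(f, g)` for
each pair of maps, which is carried to the trace of `(f', g')` by the map induced by any pair of
homotopies `f ≃ f'`, `g ≃ g'`, and which is zero on coincidence-free pairs.  The coefficient of a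
class is the index of the coincidence points in this class. -/
structure CoincidenceReidemeisterTrace (A : Type*) [AddCommGroup A] where
  trace : ∀ f g : C(X, Y), ReidemeisterClass f g →₀ A
  homotopy_invariant : ∀ (f f' g g' : C(X, Y)) (F : f.Homotopy f') (G : g.Homotopy g'),
    (trace f g).mapDomain (ReidemeisterClass.transport F G) = trace f' g'
  eq_zero_of_coincidenceFree : ∀ f g : C(X, Y), coin f g = ∅ → trace f g = 0

variable {X Y}

/-- The number of essential classes of a pair of maps: the number of Reidemeister classes with a
nonzero coefficient in the Reidemeister trace. -/
def CoincidenceReidemeisterTrace.essentialNumber {A : Type*} [AddCommGroup A]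
    (T : CoincidenceReidemeisterTrace X Y A) (f g : C(X, Y)) : ℕ :=
  (T.trace f g).support.card

end Coincidence

/-! Deforming `f` and `g` apart means deforming `(f, g) : X → Y × Y` off the diagonal. As `X` is
one-dimensional, it suffices to do this for loops: all vertices are moved to one base point off the
diagonal, and then every edge becomes a loop (`IsGraphDecomposition.exists_homotopic_forall_mem`).
So the question is whether every pair of loops in `Y` is homotopic to a pair that never meets at the
same time.

If `Y` has a vertex `v` with at least three half-edges, this holds (`IsStar.coincidenceFree`): two
points can pass each other at `v`, one stepping aside into a third arm. A loop at `v` decomposes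
into excursions that leave `v` on an arm, avoid `v`, and return on an arm. During one excursion the
other point waits on a third arm, close enough to `v` to be missed; between excursions it changes
arms. Doing this for each loop in turn, while the other point stands still, gives the pair.

If there is no such vertex, a decomposition with the fewest vertices shows that `Y` is an arc or a
circle (`IsFiniteGraph.contractibleSpace_or_exists_isStar`). The circle is excluded, and on an arc
both maps are homotopic to constants, which can be chosen distinct. The vanishing of the invariants
is then formal. -/

section Graph

open scoped unitInterval

/-! ### Finite graphs as vertices and arcs. -/

/-- A decomposition of a space into a finite set `V` of vertices and a finite set `E` of arcs, each
of which is embedded away from its end points, these being vertices. -/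
structure IsGraphDecomposition {X : Type*} [TopologicalSpace X] (V : Set X) (E : Set C(I, X)) :
    Prop where
  finite_vertices : V.Finite
  finite_edges : E.Finite
  source_mem : ∀ γ ∈ E, γ 0 ∈ V
  target_mem : ∀ γ ∈ E, γ 1 ∈ V
  interior_notMem : ∀ γ ∈ E, ∀ t ∈ Set.Ioo (0 : I) 1, γ t ∉ V
  injOn : ∀ γ ∈ E, Set.InjOn γ (Set.Ioo 0 1)
  eq_of_meet : ∀ γ ∈ E, ∀ δ ∈ E, ∀ s ∈ Set.Ioo (0 : I) 1, ∀ t ∈ Set.Ioo (0 : I) 1,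
    γ s = δ t → γ = δ
  cover : ∀ x, x ∈ V ∨ ∃ γ ∈ E, ∃ t ∈ Set.Ioo (0 : I) 1, γ t = x

theorem unitInterval.eq_zero_or_eq_one_or_mem_Ioo (t : I) : t = 0 ∨ t = 1 ∨ t ∈ Set.Ioo (0 : I) 1 := by
  rcases eq_or_ne t 0 with h | h
  · exact Or.inl h
  rcases eq_or_ne t 1 with h' | h'
  · exact Or.inr (Or.inl h')
  · exact Or.inr (Or.inr ⟨unitInterval.pos_iff_ne_zero.2 h, unitInterval.lt_one_iff_ne_one.2 h'⟩)

section CWComplex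

variable {X : Type*} [TopologicalSpace X] [CWComplex (Set.univ : Set X)]

/-- The characteristic map of a `1`-cell, with domain the unit interval. -/
noncomputable def Topology.CWComplex.edge (e : RelCWComplex.cell (Set.univ : Set X) 1) : C(I, X) where
  toFun t := RelCWComplex.map 1 e (fun _ => 2 * (t : ℝ) - 1)
  continuous_toFun := by
    refine (RelCWComplex.continuousOn 1 e).comp_continuous (by fun_prop) fun t => ?_
    have h0 := t.2.1
    have h1 := t.2.2
    rw [mem_closedBall_zero_iff, pi_norm_le_iff_of_nonneg zero_le_one]
    intro _
    rw [Real.norm_eq_abs, abs_le]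
    constructor <;> linarith

theorem two_mul_sub_one_mem_ball {t : I} (ht : t ∈ Set.Ioo (0 : I) 1) :
    (fun _ => 2 * (t : ℝ) - 1 : Fin 1 → ℝ) ∈ Metric.ball 0 1 := by
  have h0 : (0 : ℝ) < t := ht.1
  have h1 : (t : ℝ) < 1 := ht.2
  rw [mem_ball_zero_iff, pi_norm_lt_iff zero_lt_one]
  intro _
  rw [Real.norm_eq_abs, abs_lt]
  constructor <;> linarith

theorem Topology.CWComplex.edge_mem_openCell (e : RelCWComplex.cell (Set.univ : Set X) 1) {t : I}
    (ht : t ∈ Set.Ioo (0 : I) 1) : CWComplex.edge e t ∈ RelCWComplex.openCell 1 e :=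
  ⟨_, two_mul_sub_one_mem_ball ht, rfl⟩

theorem Topology.CWComplex.exists_edge_eq (e : RelCWComplex.cell (Set.univ : Set X) 1) {x : X}
    (hx : x ∈ RelCWComplex.openCell 1 e) : ∃ t ∈ Set.Ioo (0 : I) 1, CWComplex.edge e t = x := by
  obtain ⟨y, hy, rfl⟩ := hx
  rw [mem_ball_zero_iff, pi_norm_lt_iff zero_lt_one] at hy
  have := abs_lt.1 (hy 0)
  refine ⟨⟨(y 0 + 1) / 2, by constructor <;> linarith⟩, ⟨?_, ?_⟩, ?_⟩
  · rw [← Subtype.coe_lt_coe]; simp; linarith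
  · rw [← Subtype.coe_lt_coe]; simp; linarith
  · change RelCWComplex.map 1 e _ = _
    congr 1
    funext i
    rw [Subsingleton.elim i 0]
    simp only
    ring

/-- The end points come from the sphere, so they lie in the cell frontier, which is made of two
(possibly equal) `0`-cells. -/
theorem Topology.CWComplex.edge_endpoint_mem (e : RelCWComplex.cell (Set.univ : Set X) 1) {t : I}
    (ht : t = 0 ∨ t = 1) :
    CWComplex.edge e t ∈ ⋃ j : RelCWComplex.cell (Set.univ : Set X) 0, RelCWComplex.openCell 0 j := by
  obtain ⟨x, y, h⟩ := CWComplex.exists_cellFrontier_one_eq e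
  have h1 : CWComplex.edge e t ∈ RelCWComplex.cellFrontier 1 e := by
    refine ⟨_, ?_, rfl⟩
    rw [mem_sphere_zero_iff_norm, Pi.norm_def]
    rcases ht with rfl | rfl <;> norm_num
  rw [h, RelCWComplex.closedCell_zero_eq_singleton, RelCWComplex.closedCell_zero_eq_singleton] at h1
  simp only [RelCWComplex.openCell_zero_eq_singleton, Set.mem_iUnion]
  exact h1.elim (fun h => ⟨x, h⟩) (fun h => ⟨y, h⟩)

theorem Topology.CWComplex.isGraphDecomposition (hfin : RelCWComplex.Finite (Set.univ : Set X))
    (hdim : ∀ n : ℕ, 2 ≤ n → IsEmpty (RelCWComplex.cell (Set.univ : Set X) n)) :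
    IsGraphDecomposition
      (⋃ j : RelCWComplex.cell (Set.univ : Set X) 0, RelCWComplex.openCell 0 j)
      (Set.range (CWComplex.edge (X := X))) := by
  have hf := hfin.toFiniteType.finite_cell
  have hf0 := hf 0
  have hf1 := hf 1
  refine ⟨?_, Set.finite_range _, ?_, ?_, ?_, ?_, ?_, ?_⟩
  · refine Set.finite_iUnion fun j => ?_
    rw [RelCWComplex.openCell_zero_eq_singleton]
    exact Set.finite_singleton _
  · rintro _ ⟨e, rfl⟩
    exact CWComplex.edge_endpoint_mem e (Or.inl rfl)
  · rintro _ ⟨e, rfl⟩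
    exact CWComplex.edge_endpoint_mem e (Or.inr rfl)
  · rintro _ ⟨e, rfl⟩ t ht h
    obtain ⟨j, hj⟩ := Set.mem_iUnion.1 h
    refine Set.disjoint_left.1 (CWComplex.disjoint_openCell_of_ne (n := 1) (m := 0) ?_)
      (CWComplex.edge_mem_openCell e ht) hj
    simp
  · rintro _ ⟨e, rfl⟩ s hs t ht h
    have := (RelCWComplex.map 1 e).injOn
      (by rw [RelCWComplex.source_eq]; exact two_mul_sub_one_mem_ball hs)
      (by rw [RelCWComplex.source_eq]; exact two_mul_sub_one_mem_ball ht) h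
    have := congrFun this 0
    ext
    linarith
  · rintro _ ⟨e, rfl⟩ _ ⟨e', rfl⟩ s hs t ht h
    by_contra hne
    refine Set.disjoint_left.1
      (CWComplex.disjoint_openCell_of_ne (n := 1) (m := 1) (i := e) (j := e') ?_)
      (CWComplex.edge_mem_openCell e hs) (h ▸ CWComplex.edge_mem_openCell e' ht)
    intro h'
    rw [eq_of_heq (Sigma.mk.inj h').2] at hne
    exact hne rfl
  · intro x
    have hx : x ∈ ⋃ (n) (j : RelCWComplex.cell (Set.univ : Set X) n), RelCWComplex.openCell n j := by
      rw [CWComplex.iUnion_openCell_eq_complex]; trivial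
    simp only [Set.mem_iUnion] at hx
    obtain ⟨n, j, hj⟩ := hx
    match n, j, hj with
    | 0, j, hj => exact Or.inl (Set.mem_iUnion.2 ⟨j, hj⟩)
    | 1, j, hj => exact Or.inr ⟨_, ⟨j, rfl⟩, CWComplex.exists_edge_eq j hj⟩
    | n + 2, j, hj => exact ((hdim (n + 2) (by omega)).false j).elim

end CWComplex

theorem IsFiniteGraph.exists_isGraphDecomposition (X : Type*) [TopologicalSpace X]
    [h : IsFiniteGraph X] :
    ∃ (V : Set X) (E : Set C(I, X)), IsGraphDecomposition V E := by
  obtain ⟨hC, hfin, hdim⟩ := h.exists_cwComplex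
  exact ⟨_, _, CWComplex.isGraphDecomposition hfin hdim⟩

/-! ### Deforming maps out of a graph edge by edge. -/

/-- Compatible maps `S × T → Z` on the members of a finite family of maps `S → K` which cover a
Hausdorff space `K` descend to a map `K × T → Z`. -/
theorem exists_continuousMap_prod_of_finite_cover {ι S K T Z : Type*} [Finite ι]
    [TopologicalSpace S] [CompactSpace S] [TopologicalSpace K] [T2Space K]
    [TopologicalSpace T] [CompactSpace T] [T2Space T] [TopologicalSpace Z]
    (c : ι → C(S, K)) (hc : ∀ x, ∃ i s, c i s = x) (H : ι → C(S × T, Z))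
    (hH : ∀ i j s s' t, c i s = c j s' → H i (s, t) = H j (s', t)) :
    ∃ G : C(K × T, Z), ∀ i s t, G (c i s, t) = H i (s, t) := by
  let q : C((Σ _ : ι, S × T), K × T) := ⟨fun x => (c x.1 x.2.1, x.2.2), by
    refine continuous_sigma fun i => ?_
    fun_prop⟩
  -- A continuous surjection from a compact space onto a Hausdorff space is a quotient map.
  have hq : IsQuotientMap q := by
    refine IsQuotientMap.of_surjective_continuous ?_ q.continuous
    rintro ⟨x, t⟩
    obtain ⟨i, s, rfl⟩ := hc x
    exact ⟨⟨i, s, t⟩, rfl⟩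
  let g : C((Σ _ : ι, S × T), Z) := ⟨fun x => H x.1 x.2, continuous_sigma fun i => (H i).continuous⟩
  have hg : Function.FactorsThrough g q := by
    rintro ⟨i, s, t⟩ ⟨j, s', t'⟩ h
    obtain ⟨h1, h2⟩ := Prod.mk.inj h
    change t = t' at h2
    subst h2
    exact hH i j s s' t h1
  refine ⟨hq.lift g hg, fun i s t => ?_⟩
  exact congrArg (fun f : C((Σ _ : ι, S × T), Z) => f ⟨i, s, t⟩) (hq.lift_comp g hg)

namespace IsGraphDecomposition

variable {X Z : Type*} [TopologicalSpace X] [TopologicalSpace Z] {V : Set X} {E : Set C(I, X)}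

theorem mem_vertices_iff (h : IsGraphDecomposition V E) {γ : C(I, X)} (hγ : γ ∈ E) (t : I) :
    γ t ∈ V ↔ t = 0 ∨ t = 1 := by
  constructor
  · intro hV
    rcases unitInterval.eq_zero_or_eq_one_or_mem_Ioo t with h' | h' | h'
    · exact Or.inl h'
    · exact Or.inr h'
    · exact (h.interior_notMem γ hγ t h' hV).elim
  · rintro (rfl | rfl)
    exacts [h.source_mem γ hγ, h.target_mem γ hγ]

/-- Maps on the products of the edges with the unit interval glue to a map on `X × I` if they agree
over the vertices. -/
theorem exists_glue [T2Space X] (h : IsGraphDecomposition V E) (p : X → C(I, Z))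
    (H : E → C(I × I, Z)) (h0 : ∀ (e : E) (t : I), H e (0, t) = p (e.1 0) t)
    (h1 : ∀ (e : E) (t : I), H e (1, t) = p (e.1 1) t) :
    ∃ G : C(X × I, Z), (∀ x ∈ V, ∀ t, G (x, t) = p x t) ∧
      ∀ (e : E) (s t : I), G (e.1 s, t) = H e (s, t) := by
  have := h.finite_vertices.to_subtype
  have := h.finite_edges.to_subtype
  let c : V ⊕ E → C(I, X) := Sum.elim (fun x => ContinuousMap.const I x.1) (fun e => e.1)
  let K : V ⊕ E → C(I × I, Z) := Sum.elim (fun x => (p x.1).comp ContinuousMap.snd) H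
  -- Compatibility has two cases: over a vertex every piece is given by `p`, and over any other
  -- point the arc and the parameter are unique.
  have hV : ∀ i s, c i s ∈ V → ∀ t, K i (s, t) = p (c i s) t := by
    rintro (x | e) s hs t
    · rfl
    · rcases (h.mem_vertices_iff e.2 s).1 hs with rfl | rfl
      exacts [h0 e t, h1 e t]
  have hE : ∀ i s, c i s ∉ V → ∃ e : E, i = Sum.inr e ∧ s ∈ Set.Ioo (0 : I) 1 := by
    rintro (x | e) s hs
    · exact (hs x.2).elim
    · rcases unitInterval.eq_zero_or_eq_one_or_mem_Ioo s with rfl | rfl | h'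
      · exact (hs (h.source_mem _ e.2)).elim
      · exact (hs (h.target_mem _ e.2)).elim
      · exact ⟨e, rfl, h'⟩
  obtain ⟨G, hG⟩ := exists_continuousMap_prod_of_finite_cover c (fun x => by
    rcases h.cover x with hx | ⟨γ, hγ, t, -, rfl⟩
    · exact ⟨Sum.inl ⟨x, hx⟩, 0, rfl⟩
    · exact ⟨Sum.inr ⟨γ, hγ⟩, t, rfl⟩) K (by
    intro i j s s' t hij
    by_cases hx : c i s ∈ V
    · rw [hV i s hx, hV j s' (hij ▸ hx), hij]
    · obtain ⟨e, rfl, hs⟩ := hE i s hx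
      obtain ⟨e', rfl, hs'⟩ := hE j s' (hij ▸ hx)
      obtain rfl : e = e' := Subtype.ext (h.eq_of_meet _ e.2 _ e'.2 s hs s' hs' hij)
      rw [h.injOn _ e.2 hs hs' hij])
  exact ⟨G, fun x hx t => hG (Sum.inl ⟨x, hx⟩) 0 t, fun e s t => hG (Sum.inr e) s t⟩

end IsGraphDecomposition

/-- The free homotopy of a path which moves its end points along given paths. -/
theorem exists_homotopy_moving_endpoints {Z : Type*} [TopologicalSpace Z] {x y x' y' : Z}
    (γ : Path x y) (p : Path x x') (q : Path y y') :
    ∃ H : C(I × I, Z), (∀ s, H (s, 0) = γ s) ∧ (∀ t, H (0, t) = p t) ∧ ∀ t, H (1, t) = q t := by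
  -- `A` runs along `p` backwards on `[-1, 0]`, along `γ` on `[0, 1]` and along `q` on `[1, 2]`; at
  -- time `t` the homotopy traverses `[-t, 1 + t]`.
  let A : ℝ → Z := fun r =>
    if r ≤ 0 then p.extend (-r) else if r ≤ 1 then γ.extend r else q.extend (r - 1)
  have hA : Continuous A := by
    refine Continuous.if_le (by fun_prop) (Continuous.if_le (by fun_prop) (by fun_prop)
      continuous_id continuous_const ?_) continuous_id continuous_const ?_
    · rintro r rfl; simp
    · rintro r rfl; simp
  refine ⟨⟨fun st => A (st.1 * (1 + 2 * st.2) - st.2), hA.comp (by fun_prop)⟩,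
    fun s => ?_, fun t => ?_, fun t => ?_⟩
  · have h0 := s.2.1
    have h1 := s.2.2
    simp only [A, ContinuousMap.coe_mk, Set.Icc.coe_zero, mul_zero, add_zero, mul_one, sub_zero, h1, if_true]
    split_ifs with h
    · obtain rfl : s = 0 := Subtype.ext (le_antisymm h h0)
      simp
    · simp
  · have h0 := t.2.1
    simp [A, h0]
  · have h0 := t.2.1
    simp only [A, ContinuousMap.coe_mk, Set.Icc.coe_one, one_mul]
    rw [if_neg (by linarith)]
    split_ifs with h
    · obtain rfl : t = 0 := Subtype.ext (le_antisymm (by simp; linarith) h0)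
      simp
    · rw [show (1 + 2 * (t : ℝ) - t - 1) = t by ring]
      simp

namespace IsGraphDecomposition

variable {X Z : Type*} [TopologicalSpace X] [TopologicalSpace Z] {V : Set X} {E : Set C(I, X)}

/-- A map from a graph can be deformed so that all vertices are sent to a given point. -/
theorem exists_homotopic_eq_on_vertices [T2Space X] [PathConnectedSpace Z]
    (h : IsGraphDecomposition V E) (F : C(X, Z)) (z₀ : Z) :
    ∃ F' : C(X, Z), F.Homotopic F' ∧ ∀ x ∈ V, F' x = z₀ := by
  let p : ∀ x, Path (F x) z₀ := fun x => PathConnectedSpace.somePath _ _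
  choose H hH0 hHs hHt using fun e : E =>
    exists_homotopy_moving_endpoints (⟨F.comp e.1, rfl, rfl⟩ : Path (F (e.1 0)) (F (e.1 1)))
      (p (e.1 0)) (p (e.1 1))
  obtain ⟨G, hGV, hGE⟩ := h.exists_glue (fun x => (p x).toContinuousMap) H hHs hHt
  refine ⟨G.comp ((ContinuousMap.id X).prodMk (ContinuousMap.const X 1)),
    ⟨⟨G.comp ContinuousMap.prodSwap, fun x => ?_, fun x => rfl⟩⟩, fun x hx => ?_⟩
  · change G (x, 0) = F x
    rcases h.cover x with hx | ⟨γ, hγ, t, -, rfl⟩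
    · rw [hGV x hx]; exact (p x).source
    · rw [hGE ⟨γ, hγ⟩, hH0]; rfl
  · change G (x, 1) = z₀
    rw [hGV x hx]; exact (p x).target

/-- If every loop at `z₀` can be deformed into `W`, then so can every map from a graph. -/
theorem exists_homotopic_forall_mem [T2Space X] [PathConnectedSpace Z]
    (h : IsGraphDecomposition V E) {W : Set Z} {z₀ : Z} (hz₀ : z₀ ∈ W)
    (hW : ∀ γ : Path z₀ z₀, ∃ γ' : Path z₀ z₀, γ.Homotopic γ' ∧ ∀ t, γ' t ∈ W) (F : C(X, Z)) :
    ∃ F' : C(X, Z), F.Homotopic F' ∧ ∀ x, F' x ∈ W := by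
  obtain ⟨F₁, hF₁, hV⟩ := h.exists_homotopic_eq_on_vertices F z₀
  -- Each edge is now a loop at `z₀`. The homotopies supplied by `hW` fix end points, so they glue
  -- with the constant homotopy on the vertices.
  choose γ' hγ' hW' using fun e : E =>
    hW ⟨F₁.comp e.1, hV _ (h.source_mem _ e.2), hV _ (h.target_mem _ e.2)⟩
  let H : E → C(I × I, Z) := fun e => (hγ' e).some.toContinuousMap.comp ContinuousMap.prodSwap
  obtain ⟨G, hGV, hGE⟩ := h.exists_glue (fun x => ContinuousMap.const I z₀) H
    (fun e t => (hγ' e).some.source t) (fun e t => (hγ' e).some.target t)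
  refine ⟨G.comp ((ContinuousMap.id X).prodMk (ContinuousMap.const X 1)),
    hF₁.trans ⟨⟨G.comp ContinuousMap.prodSwap, fun x => ?_, fun x => rfl⟩⟩, fun x => ?_⟩
  · change G (x, 0) = F₁ x
    rcases h.cover x with hx | ⟨γ, hγ, t, -, rfl⟩
    · rw [hGV x hx, hV x hx]; rfl
    · rw [hGE ⟨γ, hγ⟩]
      exact (hγ' ⟨γ, hγ⟩).some.apply_zero t
  · change G (x, 1) ∈ W
    rcases h.cover x with hx | ⟨γ, hγ, t, -, rfl⟩
    · rw [hGV x hx]; exact hz₀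
    · rw [hGE ⟨γ, hγ⟩]
      change (hγ' ⟨γ, hγ⟩).some (1, t) ∈ W
      rw [(hγ' ⟨γ, hγ⟩).some.apply_one]
      exact hW' _ t

end IsGraphDecomposition

/-! ### Pairs of path classes without coincidences. -/

namespace Path.Homotopic.Quotient

variable {Y : Type*} [TopologicalSpace Y] {a b c d : Y}

theorem trans_symm_trans (P : Path.Homotopic.Quotient a b) (Q : Path.Homotopic.Quotient a c) :
    P.trans (P.symm.trans Q) = Q := by
  rw [← trans_assoc, trans_symm, refl_trans]

theorem symm_trans_trans (P : Path.Homotopic.Quotient a b) (Q : Path.Homotopic.Quotient b c) :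
    P.symm.trans (P.trans Q) = Q := by
  rw [← trans_assoc, symm_trans, refl_trans]

theorem symm_refl (a : Y) : (refl a).symm = refl a :=
  congrArg mk Path.refl_symm

theorem cast_trans (P : Path.Homotopic.Quotient a b) (Q : Path.Homotopic.Quotient b c) (h : d = a) :
    (P.cast h rfl).trans Q = (P.trans Q).cast h rfl := by
  subst h
  simp

/-- Two homotopy classes of paths are jointly coincidence-free if they have representatives which
never meet at the same time. -/
def CoincidenceFree {a a' b b' : Y} (P : Path.Homotopic.Quotient a a')
    (Q : Path.Homotopic.Quotient b b') : Prop :=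
  ∃ (p : Path a a') (q : Path b b'), mk p = P ∧ mk q = Q ∧ ∀ t, p t ≠ q t

namespace CoincidenceFree

variable {a a' a'' b b' b'' : Y} {P : Path.Homotopic.Quotient a a'} {Q : Path.Homotopic.Quotient b b'}
  {P' : Path.Homotopic.Quotient a' a''} {Q' : Path.Homotopic.Quotient b' b''}

theorem swap (h : CoincidenceFree P Q) : CoincidenceFree Q P := by
  obtain ⟨p, q, hp, hq, hpq⟩ := h
  exact ⟨q, p, hq, hp, fun t => (hpq t).symm⟩

theorem symm (h : CoincidenceFree P Q) : CoincidenceFree P.symm Q.symm := by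
  obtain ⟨p, q, rfl, rfl, hpq⟩ := h
  exact ⟨p.symm, q.symm, rfl, rfl, fun t => hpq _⟩

theorem trans (h : CoincidenceFree P Q) (h' : CoincidenceFree P' Q') :
    CoincidenceFree (P.trans P') (Q.trans Q') := by
  obtain ⟨p, q, rfl, rfl, hpq⟩ := h
  obtain ⟨p', q', rfl, rfl, hpq'⟩ := h'
  refine ⟨p.trans p', q.trans q', rfl, rfl, fun t => ?_⟩
  rw [Path.trans_apply, Path.trans_apply]
  split_ifs
  exacts [hpq _, hpq' _]

end CoincidenceFree

/-- A path avoiding a point does not meet the constant path at this point. -/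
theorem coincidenceFree_mk_refl {p : Path a b} (h : ∀ t, p t ≠ c) :
    CoincidenceFree (mk p) (refl c) :=
  ⟨p, Path.refl c, rfl, rfl, h⟩

end Path.Homotopic.Quotient

open Path.Homotopic.Quotient (mk CoincidenceFree coincidenceFree_mk_refl)

/-! ### Avoiding coincidences near a branch point. -/

/-- The arms `φ i` form a star with centre `v`, which is a neighbourhood of `v`: they start at `v`
and are otherwise disjoint. -/
structure IsStar {Y ι : Type*} [TopologicalSpace Y] (v : Y) (φ : ι → C(I, Y)) : Prop where
  intro ::
  source : ∀ i, φ i 0 = v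
  parameter_eq : ∀ i j s t, φ i s = φ j t → s = t
  index_eq : ∀ i j s t, φ i s = φ j t → s ≠ 0 → i = j
  isOpen : IsOpen {y | ∃ i s, s ≠ 1 ∧ φ i s = y}

namespace IsStar

variable {Y ι : Type*} [TopologicalSpace Y] {v : Y} {φ : ι → C(I, Y)}

theorem ne_center (h : IsStar v φ) {i : ι} {s : I} (hs : s ≠ 0) : φ i s ≠ v := fun he =>
  hs (h.parameter_eq i i s 0 (he.trans (h.source i).symm))

/-- The path along an arm of a star from its centre to a given point. -/
def ray (h : IsStar v φ) (i : ι) (s : I) : Path v (φ i s) where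
  toFun t := φ i (t * s)
  source' := by rw [zero_mul, h.source]
  target' := by rw [one_mul]

/-- The homotopy class of paths along an arm of a star, as a property. -/
def IsRay (h : IsStar v φ) {y : Y} (P : Path.Homotopic.Quotient v y) : Prop :=
  ∃ (i : ι) (s : I) (e : φ i s = y), P = (mk (h.ray i s)).cast rfl e.symm

theorem isRay_mk_ray (h : IsStar v φ) (i : ι) (s : I) : h.IsRay (mk (h.ray i s)) :=
  ⟨i, s, rfl, by simp⟩

/-- Different arms meet only at the centre, and `t ≠ 0` keeps the standing point away from it. -/
theorem coincidenceFree_ray_refl (h : IsStar v φ) {i k : ι} (hik : i ≠ k) (s : I) {t : I}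
    (ht : t ≠ 0) : CoincidenceFree (mk (h.ray i s)) (.refl (φ k t)) :=
  coincidenceFree_mk_refl fun _ he => hik (h.index_eq k i t _ he.symm ht).symm

/-- While one point makes an excursion from the centre into a third arm, another one can move from
one arm to another. -/
theorem coincidenceFree_refl_symm_ray_trans_ray (h : IsStar v φ) {j k l : ι} (hjk : j ≠ k)
    (hjl : j ≠ l) {s t : I} (hs : s ≠ 0) (ht : t ≠ 0) :
    CoincidenceFree (.refl v) ((mk (h.ray k s)).symm.trans (mk (h.ray l t))) := by
  have hk := (h.coincidenceFree_ray_refl hjk.symm s (one_ne_zero (α := I))).swap.symm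
  have hl := (h.coincidenceFree_ray_refl hjl.symm t (one_ne_zero (α := I))).swap
  -- The first point goes to the tip of arm `j`, waits there while the second crosses the centre
  -- from arm `k` to arm `l`, and comes back; its path is null-homotopic.
  have := (h.coincidenceFree_ray_refl hjk 1 hs).trans
    ((hk.trans hl).trans (h.coincidenceFree_ray_refl hjl 1 ht).symm)
  simpa [Path.Homotopic.Quotient.symm_refl, Path.Homotopic.Quotient.trans_symm,
    Path.Homotopic.Quotient.trans_refl, Path.Homotopic.Quotient.refl_trans] using this

/-- The loops at the centre which are coincidence-free with a constant path on any arm. -/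
def IsFreeLoop (_ : IsStar v φ) (P : Path.Homotopic.Quotient v v) : Prop :=
  ∀ (k : ι) (t : I), t ≠ 0 → CoincidenceFree P (.refl (φ k t))

section

variable (h : IsStar v φ) (h3 : ∀ i j : ι, ∃ k, k ≠ i ∧ k ≠ j)
include h3

/-- The standing point is carried from its new position to the old one before the loop and back
afterwards. Its track cancels, and the evasive trips of the other point into a third arm are
null-homotopic. -/
theorem isFreeLoop_of_coincidenceFree {P : Path.Homotopic.Quotient v v} {k : ι} {t : I} (ht : t ≠ 0)
    (hP : CoincidenceFree P (.refl (φ k t))) : h.IsFreeLoop P := by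
  have key : ∀ {k l : ι} {s t : I}, s ≠ 0 → t ≠ 0 → k ≠ l → CoincidenceFree P (.refl (φ k t)) →
      CoincidenceFree P (.refl (φ l s)) := by
    intro k l s t hs ht hkl hP
    obtain ⟨j, hjk, hjl⟩ := h3 k l
    have := (h.coincidenceFree_refl_symm_ray_trans_ray hjl hjk hs ht).trans
      (hP.trans (h.coincidenceFree_refl_symm_ray_trans_ray hjk hjl ht hs))
    simpa [Path.Homotopic.Quotient.trans_assoc, Path.Homotopic.Quotient.trans_symm_trans,
      Path.Homotopic.Quotient.symm_trans, Path.Homotopic.Quotient.trans_refl,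
      Path.Homotopic.Quotient.refl_trans] using this
  intro l s hs
  -- The detour through a further arm `j` also covers `l = k` with a different parameter.
  obtain ⟨j, hjk, hjl⟩ := h3 k l
  exact key hs one_ne_zero hjl (key (s := 1) one_ne_zero ht hjk.symm hP)

/-- A loop which leaves the centre on one arm, avoids the centre, and returns to it on another arm
can be made coincidence-free with a point on a third arm. -/
theorem isFreeLoop_excursion [T2Space Y] {y z : Y} {P : Path.Homotopic.Quotient v y}
    {Q : Path.Homotopic.Quotient v z} (hP : h.IsRay P) (hQ : h.IsRay Q) (ω : Path y z)
    (hω : ∀ t, ω t ≠ v) : h.IsFreeLoop (P.trans ((mk ω).trans Q.symm)) := by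
  obtain ⟨i, s, rfl, rfl⟩ := hP
  obtain ⟨j, t, rfl, rfl⟩ := hQ
  simp only [Path.Homotopic.Quotient.cast_rfl_rfl]
  obtain ⟨k, hki, hkj⟩ := h3 i j
  -- The compact image of `ω` misses `v`, hence also a point `φ k ε` with `ε ≠ 0` on the third arm.
  have hopen : IsOpen (φ k ⁻¹' (Set.range ω)ᶜ) :=
    (isCompact_range ω.continuous).isClosed.isOpen_compl.preimage (φ k).continuous
  have h0 : (0 : I) ∈ φ k ⁻¹' (Set.range ω)ᶜ := by
    rintro ⟨t, ht⟩
    exact hω t (ht.trans (h.source k))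
  obtain ⟨ε, hε, hε0⟩ : ∃ ε ∈ φ k ⁻¹' (Set.range ω)ᶜ, ε ≠ 0 := by
    have := (mem_nhdsWithin_of_mem_nhds (hopen.mem_nhds h0) : _ ∈ 𝓝[≠] (0 : I))
    obtain ⟨ε, h1, h2⟩ := Filter.nonempty_of_mem (Filter.inter_mem this self_mem_nhdsWithin)
    exact ⟨ε, h1, h2⟩
  have h1 := h.coincidenceFree_ray_refl hki.symm s hε0
  have h2 := (h.coincidenceFree_ray_refl hkj.symm t hε0).symm
  have h3' : CoincidenceFree (mk ω) (.refl (φ k ε)) :=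
    coincidenceFree_mk_refl fun t ht => hε ⟨t, ht⟩
  refine h.isFreeLoop_of_coincidenceFree h3 (k := k) hε0 ?_
  simpa [Path.Homotopic.Quotient.symm_refl, Path.Homotopic.Quotient.refl_trans]
    using h1.trans (h3'.trans h2)

end

/-- Stars are simply connected. -/
theorem isRay_trans_mk_eq [Finite ι] [T2Space Y] (h : IsStar v φ) {y z : Y}
    {P : Path.Homotopic.Quotient v y} {Q : Path.Homotopic.Quotient v z} (hP : h.IsRay P)
    (hQ : h.IsRay Q) (ω : Path y z) (hω : ∀ t, ∃ i s, φ i s = ω t) : P.trans (mk ω) = Q := by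
  obtain ⟨i, s, rfl, rfl⟩ := hP
  obtain ⟨j, t, rfl, rfl⟩ := hQ
  simp only [Path.Homotopic.Quotient.cast_rfl_rfl]
  -- Scaling the arms contracts the star `K` to its centre, and the track of each point is its ray.
  -- Naturality of the tracks along `ω` is the claim.
  let K := {y : Y // ∃ i s, φ i s = y}
  let c : ι → C(I, K) := fun i => ⟨fun s => ⟨φ i s, i, s, rfl⟩, by fun_prop⟩
  let H : ι → C(I × I, Y) := fun i => ⟨fun x => φ i (x.2 * x.1), by fun_prop⟩
  obtain ⟨G, hG⟩ := exists_continuousMap_prod_of_finite_cover c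
    (fun x => ⟨x.2.choose, x.2.choose_spec.choose, Subtype.ext x.2.choose_spec.choose_spec⟩) H (by
      intro i j s s' t hij
      have hij' : φ i s = φ j s' := congrArg Subtype.val hij
      obtain rfl := h.parameter_eq i j s s' hij'
      change φ i (t * s) = φ j (t * s)
      rcases eq_or_ne s 0 with rfl | hs
      · rw [mul_zero, h.source, h.source]
      · rw [h.index_eq i j s s hij' hs])
  let F : (ContinuousMap.const K v).Homotopy ⟨Subtype.val, continuous_subtype_val⟩ :=
    { toContinuousMap := G.comp ContinuousMap.prodSwap
      map_zero_left := by
        rintro ⟨_, i, s, rfl⟩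
        change G (c i s, 0) = v
        rw [hG]
        change φ i (0 * s) = v
        rw [zero_mul, h.source]
      map_one_left := by
        rintro ⟨_, i, s, rfl⟩
        change G (c i s, 1) = φ i s
        rw [hG]
        change φ i (1 * s) = φ i s
        rw [one_mul] }
  have hF : ∀ i s, F.evalAt (c i s) = h.ray i s := by
    intro i s
    ext t
    exact hG i s t
  let ω' : Path (c i s) (c j t) :=
    { toFun := fun t => ⟨ω t, hω t⟩
      continuous_toFun := by fun_prop
      source' := Subtype.ext ω.source
      target' := Subtype.ext ω.target }
  have := Path.Homotopic.Quotient.eq.2 (Path.Homotopic.map_trans_evalAt F ω')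
  rw [Path.Homotopic.Quotient.mk_trans, Path.Homotopic.Quotient.mk_trans, hF, hF] at this
  refine Eq.trans this.symm ?_
  exact Path.Homotopic.Quotient.refl_trans _

section

variable (h : IsStar v φ)

/-- A path class starting at the centre of a star which is a ray, or a ray followed by a path
avoiding the centre. -/
def IsSimple {y : Y} (P : Path.Homotopic.Quotient v y) : Prop :=
  h.IsRay P ∨ ∃ (z : Y) (Q : Path.Homotopic.Quotient v z) (ω : Path z y),
    h.IsRay Q ∧ (∀ t, ω t ≠ v) ∧ P = Q.trans (mk ω)

/-- A path class which is the product of a free loop and a simple path. -/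
def IsReducible {y : Y} (R : Path.Homotopic.Quotient v y) : Prop :=
  ∃ P S, h.IsFreeLoop P ∧ h.IsSimple S ∧ R = P.trans S

variable {h} {y z : Y} {R : Path.Homotopic.Quotient v y}

theorem IsReducible.trans_of_ne_center (hR : h.IsReducible R) (ω : Path y z) (hω : ∀ t, ω t ≠ v) :
    h.IsReducible (R.trans (mk ω)) := by
  obtain ⟨P, S, hP, hS, rfl⟩ := hR
  refine ⟨P, S.trans (mk ω), hP, Or.inr ?_, Path.Homotopic.Quotient.trans_assoc _ _ _⟩
  rcases hS with hS | ⟨x, Q, ω', hQ, hω', rfl⟩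
  · exact ⟨y, S, ω, hS, hω, rfl⟩
  · refine ⟨x, Q, ω'.trans ω, hQ, fun t => ?_, Path.Homotopic.Quotient.trans_assoc _ _ _⟩
    rw [Path.trans_apply]
    split_ifs
    exacts [hω' _, hω _]

/-- If the simple part is a ray, it and `ω` together amount to the ray `B`. Otherwise its excursion
`ω'` ends in the star: closing it by the ray `A` gives a loop that is free by `isFreeLoop_excursion`
and is absorbed into `P`, after which the path restarts with `B`. -/
theorem IsReducible.trans_of_mem_star [Finite ι] [T2Space Y]
    (h3 : ∀ i j : ι, ∃ k, k ≠ i ∧ k ≠ j) (hR : h.IsReducible R) (ω : Path y z)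
    (hω : ∀ t, ∃ i s, φ i s = ω t) : h.IsReducible (R.trans (mk ω)) := by
  obtain ⟨P, S, hP, hS, rfl⟩ := hR
  have hray : ∀ {x : Y}, (∃ i s, φ i s = x) → ∃ Q : Path.Homotopic.Quotient v x, h.IsRay Q := by
    rintro _ ⟨i, s, rfl⟩
    exact ⟨_, h.isRay_mk_ray i s⟩
  obtain ⟨A, hA⟩ := hray (by simpa using hω 0)
  obtain ⟨B, hB⟩ := hray (by simpa using hω 1)
  have hAB := h.isRay_trans_mk_eq hA hB ω hω
  rcases hS with hS | ⟨x, Q, ω', hQ, hω', rfl⟩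
  · refine ⟨P, B, hP, Or.inl hB, ?_⟩
    rw [Path.Homotopic.Quotient.trans_assoc, h.isRay_trans_mk_eq hS hB ω hω]
  · refine ⟨P.trans (Q.trans ((mk ω').trans A.symm)), B, fun k t ht => ?_, Or.inl hB, ?_⟩
    · have := (hP k t ht).trans (h.isFreeLoop_excursion h3 hQ hA ω' hω' k t ht)
      rwa [Path.Homotopic.Quotient.refl_trans] at this
    · rw [← hAB]
      simp only [Path.Homotopic.Quotient.trans_assoc, Path.Homotopic.Quotient.symm_trans_trans]

/-- A simple path ending at the centre is a ray of length zero, since the other kind ends away from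
the centre. -/
theorem IsReducible.isFreeLoop (hR : h.IsReducible R) (hy : y = v) :
    h.IsFreeLoop (R.cast rfl hy.symm) := by
  subst hy
  rw [Path.Homotopic.Quotient.cast_rfl_rfl]
  obtain ⟨P, S, hP, ⟨i, s, hs, rfl⟩ | ⟨x, Q, ω, -, hω, -⟩, rfl⟩ := hR
  · obtain rfl : s = 0 := by
      by_contra hne
      exact h.ne_center hne hs
    have : h.ray i 0 = (Path.refl y).cast rfl hs := by
      ext t
      change φ i (t * 0) = y
      rw [mul_zero, hs]
    rw [this, Path.Homotopic.Quotient.mk_cast, Path.Homotopic.Quotient.cast_cast,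
      Path.Homotopic.Quotient.cast_rfl_rfl, Path.Homotopic.Quotient.mk_refl,
      Path.Homotopic.Quotient.trans_refl]
    exact hP
  · exact (hω 1 ω.target).elim

theorem isReducible_refl [Nonempty ι] : h.IsReducible (Path.Homotopic.Quotient.refl v) := by
  obtain ⟨i⟩ := ‹Nonempty ι›
  have hs := h.source i
  refine ⟨.refl v, .refl v, fun k t ht => ?_, Or.inl ⟨i, 0, hs, ?_⟩,
    (Path.Homotopic.Quotient.trans_refl _).symm⟩
  · exact coincidenceFree_mk_refl fun _ he => h.ne_center ht he.symm
  · have : h.ray i 0 = (Path.refl v).cast rfl hs := by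
      ext t
      change φ i (t * 0) = v
      rw [mul_zero, hs]
    rw [this, Path.Homotopic.Quotient.mk_cast, Path.Homotopic.Quotient.cast_cast,
      Path.Homotopic.Quotient.cast_rfl_rfl, Path.Homotopic.Quotient.mk_refl]

variable (h) in
/-- Every loop at the centre of a star with at least three arms is free. -/
theorem isFreeLoop [Finite ι] [Nonempty ι] [T2Space Y] (h3 : ∀ i j : ι, ∃ k, k ≠ i ∧ k ≠ j)
    (P : Path.Homotopic.Quotient v v) : h.IsFreeLoop P := by
  induction P using Path.Homotopic.Quotient.ind with | mk α
  let N : Set Y := {y | ∃ i s, s ≠ 1 ∧ φ i s = y}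
  obtain ⟨i⟩ := ‹Nonempty ι›
  -- By compactness `α` is cut into finitely many pieces, each inside the star or missing `v`;
  -- reducibility is then propagated along the initial segments `R`.
  let c : Bool → Set I := fun b => if b then α ⁻¹' N else α ⁻¹' {v}ᶜ
  obtain ⟨t, ht0, htm, ⟨n, hn⟩, htc⟩ := exists_monotone_Icc_subset_open_cover_unitInterval (c := c)
    (by
      rintro (_ | _)
      · exact isOpen_compl_singleton.preimage α.continuous
      · exact h.isOpen.preimage α.continuous)
    (by
      intro s _
      rw [Set.mem_iUnion]
      by_cases hs : α s = v
      · exact ⟨true, i, 0, zero_ne_one, (h.source i).trans hs.symm⟩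
      · exact ⟨false, hs⟩)
  let R : ∀ s, Path.Homotopic.Quotient v (α s) := fun s =>
    (mk (α.subpath 0 s)).cast α.source.symm rfl
  have hR : ∀ m, h.IsReducible (R (t m)) := by
    intro m
    induction m with
    | zero =>
      have : ∀ {y} (e : y = v), h.IsReducible ((Path.Homotopic.Quotient.refl y).cast e.symm rfl) := by
        rintro _ rfl
        rw [Path.Homotopic.Quotient.cast_rfl_rfl]
        exact isReducible_refl (h := h)
      rw [ht0]
      change h.IsReducible ((mk (α.subpath 0 0)).cast α.source.symm rfl)
      rw [Path.subpath_self]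
      exact this α.source
    | succ m ih =>
      have hstep : R (t (m + 1)) = (R (t m)).trans (mk (α.subpath (t m) (t (m + 1)))) := by
        change _ = (Path.Homotopic.Quotient.cast _ _ _).trans _
        rw [Path.Homotopic.Quotient.cast_trans, ← Path.Homotopic.Quotient.mk_trans,
          Path.Homotopic.Quotient.eq.2 ⟨Path.Homotopy.subpathTransSubpath α 0 (t m) (t (m + 1))⟩]
      rw [hstep]
      have hmem : ∀ s, ∃ r ∈ Set.Icc (t m) (t (m + 1)), α r = α.subpath (t m) (t (m + 1)) s := by
        intro s
        have := Path.range_subpath_of_le α (t m) (t (m + 1)) (htm (Nat.le_succ m))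
        have hs : α.subpath (t m) (t (m + 1)) s ∈ Set.range (α.subpath (t m) (t (m + 1))) := ⟨s, rfl⟩
        rw [this] at hs
        exact hs
      obtain ⟨_ | _, hb⟩ := htc m
      · refine ih.trans_of_ne_center _ fun s => ?_
        obtain ⟨r, hr, hrs⟩ := hmem s
        rw [← hrs]
        exact hb hr
      · refine ih.trans_of_mem_star h3 _ fun s => ?_
        obtain ⟨r, hr, hrs⟩ := hmem s
        rw [← hrs]
        obtain ⟨i, s, -, hs⟩ := hb hr
        exact ⟨i, s, hs⟩
  have hR1 : h.IsReducible (R 1) := hn n le_rfl ▸ hR n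
  have := hR1.isFreeLoop α.target
  rwa [show (R 1).cast rfl α.target.symm = mk α from by
    change ((mk (α.subpath 0 1)).cast _ _).cast _ _ = _
    rw [Path.subpath_zero_one, Path.Homotopic.Quotient.mk_cast, Path.Homotopic.Quotient.cast_cast,
      Path.Homotopic.Quotient.cast_cast, Path.Homotopic.Quotient.cast_rfl_rfl]] at this

end

/-- Any two loops, one at the centre of a star with at least three arms and one at the tip of an arm,
are jointly coincidence-free. -/
theorem coincidenceFree [Finite ι] [Nonempty ι] [T2Space Y] (h : IsStar v φ)
    (h3 : ∀ i j : ι, ∃ k, k ≠ i ∧ k ≠ j) (k : ι) (P : Path.Homotopic.Quotient v v)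
    (Q : Path.Homotopic.Quotient (φ k 1) (φ k 1)) : CoincidenceFree P Q := by
  obtain ⟨l, hlk, -⟩ := h3 k k
  have h1 := h.isFreeLoop h3 P k 1 one_ne_zero
  have h2 := (h.isFreeLoop h3 ((mk (h.ray k 1)).trans (Q.trans (mk (h.ray k 1)).symm))
    l 1 one_ne_zero).swap
  have h3 := h.coincidenceFree_ray_refl hlk 1 (one_ne_zero (α := I))
  have h4 := (h.coincidenceFree_ray_refl hlk.symm 1 (one_ne_zero (α := I))).swap
  -- The first point runs through `P` and goes to the tip of arm `l`. The second returns to the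
  -- centre, performs the conjugate of `Q` there, and goes back to its tip; then the first returns.
  have := h1.trans (h3.trans ((h4.symm.trans (h2.trans h4)).trans h3.symm))
  simpa [Path.Homotopic.Quotient.symm_refl, Path.Homotopic.Quotient.trans_assoc,
    Path.Homotopic.Quotient.symm_trans_trans, Path.Homotopic.Quotient.symm_trans, Path.Homotopic.Quotient.trans_symm,
    Path.Homotopic.Quotient.trans_refl, Path.Homotopic.Quotient.refl_trans] using this

end IsStar

/-! ### Arcs in both directions and the star of half-edges. -/

namespace ContinuousMap

variable {X : Type*} [TopologicalSpace X]

/-- The reverse of an arc. -/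
def arcReverse (γ : C(I, X)) : C(I, X) := γ.comp ⟨unitInterval.symm, unitInterval.continuous_symm⟩

/-- The image of the open unit interval under an arc. -/
def arcInterior (γ : C(I, X)) : Set X := γ '' Set.Ioo 0 1

variable {γ : C(I, X)}

theorem arcReverse_apply (γ : C(I, X)) (t : I) : γ.arcReverse t = γ (unitInterval.symm t) := rfl

@[simp] theorem arcReverse_zero (γ : C(I, X)) : γ.arcReverse 0 = γ 1 := by simp [arcReverse_apply]

@[simp] theorem arcReverse_one (γ : C(I, X)) : γ.arcReverse 1 = γ 0 := by simp [arcReverse_apply]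

@[simp] theorem arcReverse_arcReverse (γ : C(I, X)) : γ.arcReverse.arcReverse = γ := by
  ext t; simp [arcReverse_apply]

theorem _root_.unitInterval.symm_mem_Ioo {t : I} (ht : t ∈ Set.Ioo (0 : I) 1) :
    unitInterval.symm t ∈ Set.Ioo (0 : I) 1 := by
  obtain ⟨h0, h1⟩ := ht
  exact ⟨unitInterval.symm_one ▸ unitInterval.strictAnti_symm h1,
    unitInterval.symm_zero ▸ unitInterval.strictAnti_symm h0⟩

@[simp] theorem arcInterior_arcReverse (γ : C(I, X)) : γ.arcReverse.arcInterior = γ.arcInterior := by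
  ext x
  constructor
  · rintro ⟨t, ht, rfl⟩
    exact ⟨_, unitInterval.symm_mem_Ioo ht, rfl⟩
  · rintro ⟨t, ht, rfl⟩
    exact ⟨_, unitInterval.symm_mem_Ioo ht, by simp [arcReverse_apply]⟩

theorem injOn_arcReverse (h : Set.InjOn γ (Set.Ioo 0 1)) : Set.InjOn γ.arcReverse (Set.Ioo 0 1) :=
  fun _ hs _ ht hst => unitInterval.symm_inj.1
    (h (unitInterval.symm_mem_Ioo hs) (unitInterval.symm_mem_Ioo ht) hst)

theorem ne_arcReverse (h : Set.InjOn γ (Set.Ioo 0 1)) : γ ≠ γ.arcReverse := by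
  intro he
  -- Any interior point other than the midpoint, which reversal fixes, would do.
  let t : I := ⟨1 / 3, by norm_num, by norm_num⟩
  have ht : t ∈ Set.Ioo (0 : I) 1 := by
    constructor <;> rw [← Subtype.coe_lt_coe] <;> norm_num [t]
  have h1 := h ht (unitInterval.symm_mem_Ioo ht) (DFunLike.congr_fun he t)
  have h2 := congrArg Subtype.val h1
  norm_num [t, unitInterval.coe_symm_eq] at h2

end ContinuousMap

open ContinuousMap

/-- A decomposition of a space into vertices and arcs, in which every arc occurs in both
directions. -/
structure IsSymmetricGraphDecomposition {X : Type*} [TopologicalSpace X] (V : Set X)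
    (E : Set C(I, X)) : Prop where
  finite_vertices : V.Finite
  finite_edges : E.Finite
  reverse_mem : ∀ γ ∈ E, γ.arcReverse ∈ E
  source_mem : ∀ γ ∈ E, γ 0 ∈ V
  interior_notMem : ∀ γ ∈ E, ∀ x ∈ γ.arcInterior, x ∉ V
  injOn : ∀ γ ∈ E, Set.InjOn γ (Set.Ioo 0 1)
  eq_or_eq : ∀ γ ∈ E, ∀ δ ∈ E, ∀ x ∈ γ.arcInterior, x ∈ δ.arcInterior → δ = γ ∨ δ = γ.arcReverse
  cover : ∀ x, x ∈ V ∨ ∃ γ ∈ E, x ∈ γ.arcInterior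

theorem IsGraphDecomposition.symmetrize {X : Type*} [TopologicalSpace X] {V : Set X}
    {E : Set C(I, X)} (h : IsGraphDecomposition V E) :
    IsSymmetricGraphDecomposition V (E ∪ arcReverse '' E) where
  finite_vertices := h.finite_vertices
  finite_edges := h.finite_edges.union (h.finite_edges.image _)
  reverse_mem := by
    rintro γ (hγ | ⟨γ, hγ, rfl⟩)
    · exact Or.inr ⟨γ, hγ, rfl⟩
    · exact Or.inl (by simpa using hγ)
  source_mem := by
    rintro γ (hγ | ⟨γ, hγ, rfl⟩)
    · exact h.source_mem γ hγ
    · simpa using h.target_mem γ hγ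
  interior_notMem := by
    have key : ∀ γ ∈ E, ∀ x ∈ γ.arcInterior, x ∉ V := by
      rintro γ hγ _ ⟨t, ht, rfl⟩
      exact h.interior_notMem γ hγ t ht
    rintro γ (hγ | ⟨γ, hγ, rfl⟩)
    · exact key γ hγ
    · simpa using key γ hγ
  injOn := by
    rintro γ (hγ | ⟨γ, hγ, rfl⟩)
    · exact h.injOn γ hγ
    · exact injOn_arcReverse (h.injOn γ hγ)
  eq_or_eq := by
    have key : ∀ γ ∈ E, ∀ δ ∈ E, ∀ x ∈ γ.arcInterior, x ∈ δ.arcInterior → γ = δ := by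
      rintro γ hγ δ hδ _ ⟨s, hs, rfl⟩ ⟨t, ht, hst⟩
      exact h.eq_of_meet γ hγ δ hδ s hs t ht hst.symm
    rintro γ (hγ | ⟨γ, hγ, rfl⟩) δ (hδ | ⟨δ, hδ, rfl⟩) x hx hx'
    all_goals
      obtain rfl := key γ hγ δ hδ x (by simpa using hx) (by simpa using hx')
      simp
  cover := by
    intro x
    rcases h.cover x with hx | ⟨γ, hγ, t, ht, rfl⟩
    · exact Or.inl hx
    · exact Or.inr ⟨γ, Or.inl hγ, t, ht, rfl⟩

namespace IsSymmetricGraphDecomposition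

variable {X : Type*} [TopologicalSpace X] {V : Set X} {E : Set C(I, X)}

theorem target_mem (h : IsSymmetricGraphDecomposition V E) {γ : C(I, X)} (hγ : γ ∈ E) : γ 1 ∈ V := by
  simpa using h.source_mem _ (h.reverse_mem γ hγ)

theorem mem_vertices_iff (h : IsSymmetricGraphDecomposition V E) {γ : C(I, X)} (hγ : γ ∈ E) (t : I) :
    γ t ∈ V ↔ t = 0 ∨ t = 1 := by
  constructor
  · intro hV
    rcases unitInterval.eq_zero_or_eq_one_or_mem_Ioo t with h' | h' | h'
    · exact Or.inl h'
    · exact Or.inr h'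
    · exact (h.interior_notMem γ hγ _ ⟨t, h', rfl⟩ hV).elim
  · rintro (rfl | rfl)
    exacts [h.source_mem γ hγ, h.target_mem hγ]

theorem mem_Ioo_iff (h : IsSymmetricGraphDecomposition V E) {γ : C(I, X)} (hγ : γ ∈ E) (t : I) :
    t ∈ Set.Ioo (0 : I) 1 ↔ γ t ∉ V := by
  constructor
  · exact fun ht => h.interior_notMem γ hγ _ ⟨t, ht, rfl⟩
  · intro hV
    rw [h.mem_vertices_iff hγ] at hV
    rcases unitInterval.eq_zero_or_eq_one_or_mem_Ioo t with h' | h' | h'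
    exacts [(hV (Or.inl h')).elim, (hV (Or.inr h')).elim, h']

theorem param_eq (h : IsSymmetricGraphDecomposition V E) {γ δ : C(I, X)} (hγ : γ ∈ E) (hδ : δ ∈ E)
    {s t : I} (hs : s ∈ Set.Ioo (0 : I) 1) (hst : γ s = δ t) :
    (γ = δ ∧ s = t) ∨ (δ = γ.arcReverse ∧ s = unitInterval.symm t) := by
  have ht : t ∈ Set.Ioo (0 : I) 1 := by
    rw [h.mem_Ioo_iff hδ, ← hst, ← h.mem_Ioo_iff hγ]; exact hs
  rcases h.eq_or_eq γ hγ δ hδ (γ s) ⟨s, hs, rfl⟩ ⟨t, ht, hst.symm⟩ with rfl | rfl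
  · exact Or.inl ⟨rfl, h.injOn _ hγ hs ht hst⟩
  · exact Or.inr ⟨rfl, h.injOn _ hγ hs (unitInterval.symm_mem_Ioo ht) hst⟩

section Star

/-- The first third of an arc, parametrized by the unit interval. -/
noncomputable def initialThird (γ : C(I, X)) : C(I, X) :=
  γ.comp ⟨fun t => ⟨(t : ℝ) / 3, by have := t.2.1; positivity, by have := t.2.2; linarith⟩, by fun_prop⟩

/-- The half-edges at a vertex form a star. -/
theorem isStar [T2Space X] (h : IsSymmetricGraphDecomposition V E) {v : X}
    (hv : ∃ γ ∈ E, γ 0 = v) :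
    IsStar v (fun γ : {γ : C(I, X) // γ ∈ E ∧ γ 0 = v} => initialThird γ.1) := by
  have hvV : v ∈ V := by
    obtain ⟨γ, hγ, rfl⟩ := hv
    exact h.source_mem γ hγ
  -- Thirds keep the two half-edges of a loop disjoint: `s / 3 = 1 - t / 3` has no solution in `I`.
  let d : I → I := fun t => ⟨(t : ℝ) / 3, by have := t.2.1; positivity, by have := t.2.2; linarith⟩
  have hd0 : d 0 = 0 := by ext; simp [d]
  have hdI : ∀ t, t ≠ 0 → d t ∈ Set.Ioo (0 : I) 1 := by
    intro t ht
    have h0 : (0 : ℝ) < t := unitInterval.pos_iff_ne_zero.2 ht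
    have h1 := t.2.2
    constructor <;> rw [← Subtype.coe_lt_coe] <;> simp only [d, Set.Icc.coe_zero, Set.Icc.coe_one] <;>
      linarith
  have happ : ∀ (γ : C(I, X)) t, initialThird γ t = γ (d t) := fun _ _ => rfl
  have key : ∀ γ ∈ E, γ 0 = v → ∀ δ ∈ E, δ 0 = v → ∀ s t, γ (d s) = δ (d t) →
      s = t ∧ (s ≠ 0 → γ = δ) := by
    intro γ hγ hγv δ hδ hδv s t hst
    by_cases hs : s = 0
    · subst hs
      have : ¬ t ≠ 0 := fun ht => h.interior_notMem δ hδ _ ⟨_, hdI t ht, rfl⟩ (by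
        rw [← hst, hd0]; exact h.source_mem γ hγ)
      exact ⟨(not_not.1 this).symm, fun h => (h rfl).elim⟩
    · rcases h.param_eq hγ hδ (hdI s hs) hst with ⟨rfl, he⟩ | ⟨-, he⟩
      · have he' := congrArg Subtype.val he
        simp only [d] at he'
        exact ⟨Subtype.ext (by linarith), fun _ => rfl⟩
      · have he' := congrArg Subtype.val he
        simp only [d, unitInterval.coe_symm_eq] at he'
        have := s.2.2
        have := t.2.2
        linarith
  refine ⟨?_, ?_, ?_, ?_⟩
  · rintro ⟨γ, hγ, hγv⟩
    change γ (d 0) = v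
    rw [hd0, hγv]
  · rintro ⟨γ, hγ, hγv⟩ ⟨δ, hδ, hδv⟩ s t hst
    exact (key γ hγ hγv δ hδ hδv s t hst).1
  · rintro ⟨γ, hγ, hγv⟩ ⟨δ, hδ, hδv⟩ s t hst hs
    exact Subtype.ext ((key γ hγ hγv δ hδ hδv s t hst).2 hs)
  -- The complement of the open star is a finite union of compact sets: the other vertices, and each
  -- arc with its thirds next to `v` cut off.
  · let D : C(I, X) → Set I := fun δ => {t | (δ 0 = v → 1 / 3 ≤ (t : ℝ)) ∧ (δ 1 = v → (t : ℝ) ≤ 2 / 3)}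
    have hD : ∀ δ, IsClosed (D δ) := fun δ =>
      (isClosed_imp (by simp) (isClosed_le continuous_const continuous_subtype_val)).inter
        (isClosed_imp (by simp) (isClosed_le continuous_subtype_val continuous_const))
    have hclosed : IsClosed ((V \ {v}) ∪ ⋃ δ ∈ E, δ '' D δ) :=
      (h.finite_vertices.subset Set.sdiff_subset).isClosed.union
        (h.finite_edges.isClosed_biUnion fun δ _ => ((hD δ).isCompact.image δ.continuous).isClosed)
    convert hclosed.isOpen_compl using 1
    ext y
    constructor
    · rintro ⟨⟨γ, hγ, hγv⟩, s, hs1, rfl⟩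
      rw [happ]
      have hs1' : (s : ℝ) < 1 := unitInterval.lt_one_iff_ne_one.2 hs1
      rintro (⟨hV, hne⟩ | hU)
      · rcases eq_or_ne s 0 with rfl | hs
        · exact hne (by rw [hd0]; exact hγv)
        · exact h.interior_notMem γ hγ _ ⟨_, hdI s hs, rfl⟩ hV
      · simp only [Set.mem_iUnion] at hU
        obtain ⟨δ, hδ, t, ⟨ht0, ht1⟩, hst⟩ := hU
        rcases eq_or_ne s 0 with rfl | hs
        · rw [hd0, hγv] at hst
          rcases (h.mem_vertices_iff hδ t).1 (hst ▸ hvV) with rfl | rfl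
          · have := ht0 hst
            norm_num at this
          · have := ht1 hst
            norm_num at this
        · rcases h.param_eq hγ hδ (hdI s hs) hst.symm with ⟨rfl, rfl⟩ | ⟨rfl, he⟩
          · have := ht0 hγv
            simp only [d] at this
            linarith
          · have := ht1 (by simpa using hγv)
            have he' := congrArg Subtype.val he
            simp only [d, unitInterval.coe_symm_eq] at he'
            linarith
    · intro hy
      simp only [Set.mem_compl_iff, Set.mem_union, Set.mem_iUnion, not_or] at hy
      obtain ⟨hy1, hy2⟩ := hy
      by_contra hN
      rcases h.cover y with hyV | ⟨δ, hδ, t, ht, rfl⟩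
      · refine hy1 ⟨hyV, fun hyv => hN ?_⟩
        obtain ⟨γ, hγ, hγv⟩ := hv
        refine ⟨⟨γ, hγ, hγv⟩, 0, zero_ne_one, ?_⟩
        rw [happ, hd0, hγv]
        exact hyv.symm
      · refine hy2 ⟨δ, hδ, t, ⟨fun hδv => ?_, fun hδv => ?_⟩, rfl⟩
        · by_contra hlt
          refine hN ⟨⟨δ, hδ, hδv⟩, ⟨3 * t, by have := t.2.1; positivity, by linarith⟩, fun he => ?_, ?_⟩
          · have := congrArg Subtype.val he
            simp only [Set.Icc.coe_one] at this
            linarith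
          · rw [happ]
            congr 1
            ext
            simp only [d]
            ring
        · by_contra hlt
          have h1 := t.2.2
          refine hN ⟨⟨δ.arcReverse, h.reverse_mem δ hδ, by simpa using hδv⟩,
            ⟨3 * (1 - t), by linarith, by linarith⟩, fun he => ?_, ?_⟩
          · have := congrArg Subtype.val he
            simp only [Set.Icc.coe_one] at this
            linarith
          · rw [happ, arcReverse_apply]
            congr 1
            ext
            simp only [d, unitInterval.coe_symm_eq]
            ring

end Star

end IsSymmetricGraphDecomposition

/-! ### Removing vertices of degree two. -/

section Join

variable {X : Type*} [TopologicalSpace X] {p q : C(I, X)}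

/-- The arc which runs backwards along `p` and then along `q`, when both start at the same point. -/
noncomputable def arcJoin (p q : C(I, X)) (h : p 0 = q 0) : C(I, X) :=
  ((⟨p, rfl, rfl⟩ : Path (p 0) (p 1)).symm.trans (⟨q, h.symm, rfl⟩ : Path (p 0) (q 1))).toContinuousMap

variable (h : p 0 = q 0)

@[simp] theorem arcJoin_zero : arcJoin p q h 0 = p 1 := Path.source _

@[simp] theorem arcJoin_one : arcJoin p q h 1 = q 1 := Path.target _

theorem arcJoin_apply_of_add {a s : I} (hs : (a : ℝ) + 2 * s = 1) : arcJoin p q h s = p a := by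
  have := a.2.1
  change (Path.trans _ _) s = _
  rw [Path.trans_apply, dif_pos (by linarith), Path.symm_apply]
  change p _ = p a
  congr 1
  ext
  simp only [unitInterval.coe_symm_eq]
  linarith

theorem arcJoin_apply_of_sub {b s : I} (hs : 2 * (s : ℝ) - b = 1) : arcJoin p q h s = q b := by
  have := b.2.1
  by_cases hb : (s : ℝ) ≤ 1 / 2
  · obtain rfl : b = 0 := by
      ext
      rw [Set.Icc.coe_zero]
      linarith
    rw [← h]
    exact arcJoin_apply_of_add h (by simpa using hs)
  change (Path.trans _ _) s = _
  rw [Path.trans_apply, dif_neg hb]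
  change q _ = q b
  congr 1
  ext
  simp only
  linarith

/-- The points in the interior of a joined arc. -/
theorem mem_Ioo_arcJoin_cases {s : I} (hs : s ∈ Set.Ioo (0 : I) 1) :
    (arcJoin p q h s = p 0 ∧ (s : ℝ) = 1 / 2) ∨
      (∃ a ∈ Set.Ioo (0 : I) 1, arcJoin p q h s = p a ∧ (a : ℝ) + 2 * s = 1) ∨
      ∃ b ∈ Set.Ioo (0 : I) 1, arcJoin p q h s = q b ∧ 2 * (s : ℝ) - b = 1 := by
  have h0 : (0 : ℝ) < s := hs.1
  have h1 : (s : ℝ) < 1 := hs.2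
  rcases lt_trichotomy (s : ℝ) (1 / 2) with hlt | heq | hgt
  · refine Or.inr (Or.inl ⟨⟨1 - 2 * s, by linarith, by linarith⟩, ⟨?_, ?_⟩,
      arcJoin_apply_of_add h (by simp), by simp⟩)
    all_goals rw [← Subtype.coe_lt_coe]; simp only [Set.Icc.coe_zero, Set.Icc.coe_one]; linarith
  · exact Or.inl ⟨arcJoin_apply_of_add h (by simp [heq]), heq⟩
  · refine Or.inr (Or.inr ⟨⟨2 * s - 1, by linarith, by linarith⟩, ⟨?_, ?_⟩,
      arcJoin_apply_of_sub h (by simp), by simp⟩)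
    all_goals rw [← Subtype.coe_lt_coe]; simp only [Set.Icc.coe_zero, Set.Icc.coe_one]; linarith

theorem arcInterior_arcJoin :
    (arcJoin p q h).arcInterior = {p 0} ∪ p.arcInterior ∪ q.arcInterior := by
  ext x
  constructor
  · rintro ⟨s, hs, rfl⟩
    rcases mem_Ioo_arcJoin_cases h hs with ⟨he, -⟩ | ⟨a, ha, he, -⟩ | ⟨b, hb, he, -⟩
    · exact Or.inl (Or.inl he)
    · exact Or.inl (Or.inr ⟨a, ha, he.symm⟩)
    · exact Or.inr ⟨b, hb, he.symm⟩
  · rintro ((rfl | ⟨a, ⟨ha0, ha1⟩, rfl⟩) | ⟨b, ⟨hb0, hb1⟩, rfl⟩)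
    · refine ⟨⟨1 / 2, by norm_num, by norm_num⟩, ⟨?_, ?_⟩, arcJoin_apply_of_add h (by simp)⟩
      all_goals rw [← Subtype.coe_lt_coe]; norm_num
    · rw [← Subtype.coe_lt_coe] at ha0 ha1
      simp only [Set.Icc.coe_zero, Set.Icc.coe_one] at ha0 ha1
      refine ⟨⟨(1 - a) / 2, by linarith, by linarith⟩, ⟨?_, ?_⟩,
        arcJoin_apply_of_add h (by simp only; ring)⟩
      all_goals rw [← Subtype.coe_lt_coe]; simp only [Set.Icc.coe_zero, Set.Icc.coe_one]; linarith
    · rw [← Subtype.coe_lt_coe] at hb0 hb1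
      simp only [Set.Icc.coe_zero, Set.Icc.coe_one] at hb0 hb1
      refine ⟨⟨(1 + b) / 2, by linarith, by linarith⟩, ⟨?_, ?_⟩,
        arcJoin_apply_of_sub h (by simp only; ring)⟩
      all_goals rw [← Subtype.coe_lt_coe]; simp only [Set.Icc.coe_zero, Set.Icc.coe_one]; linarith

theorem injOn_arcJoin (hp : Set.InjOn p (Set.Ioo 0 1)) (hq : Set.InjOn q (Set.Ioo 0 1))
    (hpq : Disjoint p.arcInterior q.arcInterior) (hp0 : p 0 ∉ p.arcInterior)
    (hq0 : p 0 ∉ q.arcInterior) : Set.InjOn (arcJoin p q h) (Set.Ioo 0 1) := by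
  intro s hs t ht hst
  ext
  rcases mem_Ioo_arcJoin_cases h hs with ⟨h1, h2⟩ | ⟨a, ha, h1, h2⟩ | ⟨a, ha, h1, h2⟩ <;>
    rcases mem_Ioo_arcJoin_cases h ht with ⟨h3, h4⟩ | ⟨b, hb, h3, h4⟩ | ⟨b, hb, h3, h4⟩ <;>
    rw [h1, h3] at hst
  · linarith
  · exact (hp0 ⟨b, hb, hst.symm⟩).elim
  · exact (hq0 ⟨b, hb, hst.symm⟩).elim
  · exact (hp0 ⟨a, ha, hst⟩).elim
  · rw [hp ha hb hst] at h2
    linarith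
  · exact (Set.disjoint_left.1 hpq ⟨a, ha, rfl⟩ ⟨b, hb, hst.symm⟩).elim
  · exact (hq0 ⟨a, ha, hst⟩).elim
  · exact (Set.disjoint_left.1 hpq ⟨b, hb, rfl⟩ ⟨a, ha, hst⟩).elim
  · rw [hq ha hb hst] at h2
    linarith

end Join

namespace IsSymmetricGraphDecomposition

variable {X : Type*} [TopologicalSpace X] {V : Set X} {E : Set C(I, X)}

/-- A vertex which is the source of exactly two arcs, neither of them a loop, can be removed. -/
theorem merge (h : IsSymmetricGraphDecomposition V E) {p q : C(I, X)} (hp : p ∈ E) (hq : q ∈ E)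
    (hpq : p ≠ q) (h0 : p 0 = q 0) (hp1 : p 1 ≠ p 0) (hq1 : q 1 ≠ p 0)
    (hE : ∀ δ ∈ E, δ 0 = p 0 → δ = p ∨ δ = q) :
    ∃ E', IsSymmetricGraphDecomposition (V \ {p 0}) E' := by
  have hqp : q ≠ p.arcReverse := by
    rintro rfl
    exact hp1 (by simpa using h0.symm)
  have hdis : Disjoint p.arcInterior q.arcInterior := by
    refine Set.disjoint_left.2 fun x hx hx' => ?_
    rcases h.eq_or_eq p hp q hq x hx hx' with he | he
    exacts [hpq he.symm, hqp he]
  have hV0 : p 0 ∈ V := h.source_mem p hp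
  have hint : ∀ γ ∈ E, p 0 ∉ γ.arcInterior := fun γ hγ hx => h.interior_notMem γ hγ _ hx hV0
  let ρ := arcJoin p q h0
  have hρI : ρ.arcInterior = {p 0} ∪ p.arcInterior ∪ q.arcInterior := arcInterior_arcJoin h0
  have hρinj : Set.InjOn ρ (Set.Ioo 0 1) :=
    injOn_arcJoin h0 (h.injOn p hp) (h.injOn q hq) hdis (hint p hp) (hint q hq)
  have hρV : ∀ x ∈ ρ.arcInterior, x ∉ V \ {p 0} := by
    rw [hρI]
    rintro x ((hx | hx) | hx) ⟨hV, hne⟩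
    exacts [hne hx, h.interior_notMem p hp x hx hV, h.interior_notMem q hq x hx hV]
  -- The arcs not touching `p 0` are kept; `p`, `q` and their reverses are replaced by `ρ` and its
  -- reverse.
  let E₀ : Set C(I, X) := {γ | γ ∈ E ∧ γ 0 ≠ p 0 ∧ γ 1 ≠ p 0}
  have hE₀ : ∀ γ ∈ E₀, Disjoint γ.arcInterior ρ.arcInterior := by
    rintro γ ⟨hγ, hγ0, hγ1⟩
    rw [hρI]
    refine Set.disjoint_left.2 fun x hx => ?_
    rintro ((hx' | hx') | hx')
    · exact hint γ hγ (hx' ▸ hx)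
    · rcases h.eq_or_eq p hp γ hγ x hx' hx with rfl | rfl
      · exact hγ0 rfl
      · exact hγ1 (by simp)
    · rcases h.eq_or_eq q hq γ hγ x hx' hx with rfl | rfl
      · exact hγ0 h0.symm
      · exact hγ1 (by simp [h0])
  have hcase : ∀ γ ∈ E, γ ∈ E₀ ∨ γ.arcInterior ⊆ ρ.arcInterior := by
    intro γ hγ
    by_cases h1 : γ 0 = p 0
    · right
      rw [hρI]
      rcases hE γ hγ h1 with rfl | rfl
      · exact fun x hx => Or.inl (Or.inr hx)
      · exact fun x hx => Or.inr hx
    by_cases h2 : γ 1 = p 0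
    · right
      rw [hρI]
      rw [← arcInterior_arcReverse γ]
      rcases hE _ (h.reverse_mem γ hγ) (by simpa using h2) with h3 | h3 <;> rw [h3]
      · exact fun x hx => Or.inl (Or.inr hx)
      · exact fun x hx => Or.inr hx
    · exact Or.inl ⟨hγ, h1, h2⟩
  have hmem : ∀ γ, γ ∈ E₀ ∪ {ρ, ρ.arcReverse} → γ ∈ E₀ ∨ γ = ρ ∨ γ = ρ.arcReverse := fun γ hγ => hγ
  refine ⟨E₀ ∪ {ρ, ρ.arcReverse}, ?_, ?_, ?_, ?_, ?_, ?_, ?_, ?_⟩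
  · exact h.finite_vertices.subset Set.sdiff_subset
  · exact (h.finite_edges.subset fun γ hγ => hγ.1).union (by simp)
  · intro γ hγ
    rcases hmem γ hγ with ⟨hγ, hγ0, hγ1⟩ | rfl | rfl
    · exact Or.inl ⟨h.reverse_mem γ hγ, by simpa using hγ1, by simpa using hγ0⟩
    · exact Or.inr (Or.inr rfl)
    · exact Or.inr (Or.inl (by simp))
  · intro γ hγ
    rcases hmem γ hγ with ⟨hγ, hγ0, hγ1⟩ | rfl | rfl
    · exact ⟨h.source_mem γ hγ, hγ0⟩
    · rw [arcJoin_zero]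
      exact ⟨h.target_mem hp, hp1⟩
    · rw [arcReverse_zero, arcJoin_one]
      exact ⟨h.target_mem hq, hq1⟩
  · intro γ hγ
    rcases hmem γ hγ with ⟨hγ, hγ0, hγ1⟩ | rfl | rfl
    · exact fun x hx hx' => h.interior_notMem γ hγ x hx hx'.1
    · exact hρV
    · rwa [arcInterior_arcReverse]
  · intro γ hγ
    rcases hmem γ hγ with ⟨hγ, -, -⟩ | rfl | rfl
    exacts [h.injOn γ hγ, hρinj, injOn_arcReverse hρinj]
  · intro γ hγ δ hδ x hx hx'
    rcases hmem γ hγ with hγ | hγ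
    · rcases hmem δ hδ with hδ | hδ
      · exact h.eq_or_eq γ hγ.1 δ hδ.1 x hx hx'
      · refine (Set.disjoint_left.1 (hE₀ γ hγ) hx ?_).elim
        rcases hδ with rfl | rfl
        · exact hx'
        · simpa using hx'
    · rcases hmem δ hδ with hδ | hδ
      · refine (Set.disjoint_left.1 (hE₀ δ hδ) hx' ?_).elim
        rcases hγ with rfl | rfl
        · exact hx
        · simpa using hx
      · rcases hγ with rfl | rfl <;> rcases hδ with rfl | rfl <;> simp
  · intro x
    rcases h.cover x with hx | ⟨γ, hγ, hx⟩
    · by_cases hxp : x = p 0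
      · refine Or.inr ⟨ρ, Or.inr (Or.inl rfl), ?_⟩
        rw [hρI]
        exact Or.inl (Or.inl hxp)
      · exact Or.inl ⟨hx, hxp⟩
    · rcases hcase γ hγ with hγ' | hγ'
      · exact Or.inr ⟨γ, Or.inl hγ', hx⟩
      · exact Or.inr ⟨ρ, Or.inr (Or.inl rfl), hγ' hx⟩

/-- A connected graph is the image of a single arc if no other arc meets its end points. -/
theorem range_eq_univ [T2Space X] [ConnectedSpace X] (h : IsSymmetricGraphDecomposition V E)
    {γ : C(I, X)} (hγ : γ ∈ E)
    (hE : ∀ δ ∈ E, δ 0 = γ 0 ∨ δ 0 = γ 1 → δ = γ ∨ δ = γ.arcReverse) : Set.range γ = Set.univ := by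
  refine IsClopen.eq_univ ⟨(isCompact_range γ.continuous).isClosed, ?_⟩ ⟨γ 0, 0, rfl⟩
  -- The remaining vertices and arcs form a closed set, which by `hE` is exactly the complement of
  -- the range of `γ`.
  have hclosed : IsClosed ((V \ {γ 0, γ 1}) ∪ ⋃ δ ∈ E \ {γ, γ.arcReverse}, Set.range δ) :=
    (h.finite_vertices.subset Set.sdiff_subset).isClosed.union
      ((h.finite_edges.subset Set.sdiff_subset).isClosed_biUnion fun δ _ =>
        (isCompact_range δ.continuous).isClosed)
  convert hclosed.isOpen_compl using 1
  ext x
  simp only [Set.mem_compl_iff, Set.mem_union, Set.mem_iUnion, not_or, exists_prop, not_exists]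
  have hends : ∀ t, γ t ∈ V → γ t = γ 0 ∨ γ t = γ 1 := by
    intro t ht
    rcases (h.mem_vertices_iff hγ t).1 ht with rfl | rfl <;> simp
  constructor
  · rintro ⟨t, rfl⟩
    refine ⟨fun ⟨hV, hne⟩ => hne (hends t hV), ?_⟩
    rintro δ ⟨⟨hδ, hne⟩, s, hst⟩
    refine hne ?_
    rcases unitInterval.eq_zero_or_eq_one_or_mem_Ioo s with rfl | rfl | hs
    · refine hE δ hδ ?_
      rw [hst]
      exact hends t (hst ▸ h.source_mem δ hδ)
    · have := hE _ (h.reverse_mem δ hδ) (by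
        rw [arcReverse_zero, hst]
        exact hends t (hst ▸ h.target_mem hδ))
      rcases this with h' | h'
      · exact Or.inr (by rw [← h']; simp)
      · exact Or.inl (by rw [← arcReverse_arcReverse δ, h']; simp)
    · rcases h.param_eq hδ hγ hs hst with ⟨rfl, -⟩ | ⟨rfl, -⟩ <;> simp
  · rintro ⟨h1, h2⟩
    by_contra hx
    rcases h.cover x with hV | ⟨δ, hδ, t, ht, rfl⟩
    · refine h1 ⟨hV, ?_⟩
      rintro (rfl | rfl)
      exacts [hx ⟨0, rfl⟩, hx ⟨1, rfl⟩]
    · refine h2 δ ⟨⟨hδ, ?_⟩, t, rfl⟩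
      rintro (rfl | rfl)
      exacts [hx ⟨t, rfl⟩, hx ⟨_, rfl⟩]

end IsSymmetricGraphDecomposition

/-! ### Graphs without branch points. -/

/-- A Hausdorff space which is the image of an arc with equal end points and otherwise injective is
homeomorphic to the circle. -/
theorem nonempty_homeomorph_circle {Y : Type*} [TopologicalSpace Y] [T2Space Y] {γ : C(I, Y)}
    (hγ : Set.range γ = Set.univ) (h01 : γ 0 = γ 1) (hinj : Set.InjOn γ (Set.Ioo 0 1))
    (h0 : γ 0 ∉ γ.arcInterior) : Nonempty (Y ≃ₜ Circle) := by
  have : Fact ((0 : ℝ) < 1) := ⟨zero_lt_one⟩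
  let f : ℝ → Y := Set.IccExtend zero_le_one γ
  have hf : ∀ t : I, f t = γ t := fun t => Set.IccExtend_val _ _ _
  -- As `γ 0 = γ 1`, the arc descends to a continuous bijection from a compact space to a Hausdorff
  -- space.
  let F : AddCircle (1 : ℝ) → Y := AddCircle.liftIco 1 0 f
  have hFc : Continuous F := by
    refine AddCircle.liftIco_zero_continuous ?_ (γ.continuous.Icc_extend' (h := zero_le_one)).continuousOn
    rw [show f 0 = γ 0 from hf 0, show f 1 = γ 1 from hf 1, h01]
  have hF : ∀ t : I, t ≠ 1 → F ((t : ℝ) : AddCircle (1 : ℝ)) = γ t := by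
    intro t ht
    rw [← hf t]
    exact AddCircle.liftIco_zero_coe_apply ⟨t.2.1, unitInterval.lt_one_iff_ne_one.2 ht⟩
  have hrep : ∀ x : AddCircle (1 : ℝ), ∃ t : I, t ≠ 1 ∧ ((t : ℝ) : AddCircle (1 : ℝ)) = x := by
    intro x
    have hx := (AddCircle.equivIco (1 : ℝ) 0 x).2
    have hx1 := hx.2.trans_eq (zero_add 1)
    refine ⟨⟨AddCircle.equivIco (1 : ℝ) 0 x, hx.1, hx1.le⟩, fun he => ?_, AddCircle.coe_equivIco⟩
    exact hx1.ne (congrArg Subtype.val he)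
  have hγinj : ∀ s t : I, s ≠ 1 → t ≠ 1 → γ s = γ t → s = t := by
    intro s t hs ht hst
    rcases unitInterval.eq_zero_or_eq_one_or_mem_Ioo s with rfl | rfl | hs'
    · rcases unitInterval.eq_zero_or_eq_one_or_mem_Ioo t with rfl | rfl | ht'
      exacts [rfl, (ht rfl).elim, (h0 ⟨t, ht', hst.symm⟩).elim]
    · exact (hs rfl).elim
    · rcases unitInterval.eq_zero_or_eq_one_or_mem_Ioo t with rfl | rfl | ht'
      exacts [(h0 ⟨s, hs', hst⟩).elim, (ht rfl).elim, hinj hs' ht' hst]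
  have hbij : Function.Bijective F := by
    constructor
    · intro x y hxy
      obtain ⟨s, hs, rfl⟩ := hrep x
      obtain ⟨t, ht, rfl⟩ := hrep y
      rw [hF s hs, hF t ht] at hxy
      rw [hγinj s t hs ht hxy]
    · intro y
      obtain ⟨t, rfl⟩ : y ∈ Set.range γ := hγ ▸ Set.mem_univ y
      by_cases ht : t = 1
      · subst ht
        exact ⟨_, (hF 0 zero_ne_one).trans h01⟩
      · exact ⟨_, hF t ht⟩
  have e : AddCircle (1 : ℝ) ≃ₜ Y :=
    Continuous.homeoOfEquivCompactToT2 (f := Equiv.ofBijective F hbij) hFc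
  exact ⟨e.symm.trans (AddCircle.homeomorphCircle one_ne_zero)⟩

/-- The image of an embedded arc is contractible. -/
theorem contractibleSpace_of_arc {Y : Type*} [TopologicalSpace Y] [T2Space Y] {γ : C(I, Y)}
    (hγ : Set.range γ = Set.univ) (h01 : γ 0 ≠ γ 1) (hinj : Set.InjOn γ (Set.Ioo 0 1))
    (h0 : γ 0 ∉ γ.arcInterior) (h1 : γ 1 ∉ γ.arcInterior) : ContractibleSpace Y := by
  have hbij : Function.Bijective γ := by
    refine ⟨fun s t hst => ?_, Set.range_eq_univ.1 hγ⟩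
    rcases unitInterval.eq_zero_or_eq_one_or_mem_Ioo s with rfl | rfl | hs' <;>
      rcases unitInterval.eq_zero_or_eq_one_or_mem_Ioo t with rfl | rfl | ht'
    exacts [rfl, (h01 hst).elim, (h0 ⟨t, ht', hst.symm⟩).elim, (h01 hst.symm).elim, rfl,
      (h1 ⟨t, ht', hst.symm⟩).elim, (h0 ⟨s, hs', hst⟩).elim, (h1 ⟨s, hs', hst⟩).elim,
      hinj hs' ht' hst]
  have e : I ≃ₜ Y := Continuous.homeoOfEquivCompactToT2 (f := Equiv.ofBijective γ hbij) γ.continuous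
  have : ContractibleSpace I := (convex_Icc (0 : ℝ) 1).contractibleSpace ⟨0, by simp⟩
  exact e.symm.contractibleSpace

namespace IsSymmetricGraphDecomposition

variable {Y : Type*} [TopologicalSpace Y] [T2Space Y] [ConnectedSpace Y] [Nontrivial Y]

/-- A connected graph without branch points is contractible or a circle. -/
theorem contractibleSpace_or_circle_of_minimal {V : Set Y} {E : Set C(I, Y)}
    (h : IsSymmetricGraphDecomposition V E)
    (hmin : ∀ V' E', IsSymmetricGraphDecomposition (X := Y) V' E' → V.ncard ≤ V'.ncard)
    (h2 : ∀ α ∈ E, ∀ β ∈ E, ∀ γ ∈ E, α 0 = β 0 → α 0 = γ 0 → α = β ∨ α = γ ∨ β = γ) :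
    ContractibleSpace Y ∨ Nonempty (Y ≃ₜ Circle) := by
  have hne : E.Nonempty := by
    by_contra hE
    rw [Set.not_nonempty_iff_eq_empty] at hE
    subst hE
    -- Without arcs `Y` would be finite, but a nontrivial connected Hausdorff space is infinite.
    have hV : V = Set.univ := Set.eq_univ_of_forall fun x => by simpa using h.cover x
    exact isPreconnected_univ.infinite_of_nontrivial (Set.nontrivial_univ (α := Y))
      (hV ▸ h.finite_vertices)
  obtain ⟨γ, hγ⟩ := hne
  have hrev := h.reverse_mem γ hγ
  have hnerev := ne_arcReverse (h.injOn γ hγ)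
  have hint0 : γ 0 ∉ γ.arcInterior := fun hx => h.interior_notMem γ hγ _ hx (h.source_mem γ hγ)
  have hint1 : γ 1 ∉ γ.arcInterior := fun hx => h.interior_notMem γ hγ _ hx (h.target_mem hγ)
  by_cases h01 : γ 0 = γ 1
  · right
    -- The loop and its reverse already use up the two arcs allowed at this vertex.
    have hE : ∀ δ ∈ E, δ 0 = γ 0 → δ = γ ∨ δ = γ.arcReverse := by
      intro δ hδ h0
      rcases h2 γ hγ _ hrev δ hδ (by simpa using h01) h0.symm with h' | h' | h'
      exacts [(hnerev h').elim, Or.inl h'.symm, Or.inr h'.symm]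
    refine nonempty_homeomorph_circle (h.range_eq_univ hγ ?_) h01 (h.injOn γ hγ) hint0
    rintro δ hδ (h0 | h0)
    exacts [hE δ hδ h0, hE δ hδ (h0.trans h01.symm)]
  · left
    -- A second arc `δ` at `γ 0` is not a loop, as `δ`, its reverse and `γ` would be three arcs
    -- there. So `γ 0` could be removed by `merge`, against minimality.
    have key : ∀ γ ∈ E, γ 0 ≠ γ 1 → ∀ δ ∈ E, δ 0 = γ 0 → δ = γ := by
      intro γ hγ h01 δ hδ h0
      by_contra hne
      have hδ1 : δ 1 ≠ γ 0 := by
        intro hδ1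
        rcases h2 δ hδ _ (h.reverse_mem δ hδ) γ hγ (by simp [h0, hδ1]) h0 with h' | h' | h'
        · exact ne_arcReverse (h.injOn δ hδ) h'
        · exact hne h'
        · refine h01 ?_
          rw [← h', arcReverse_zero, arcReverse_one, h0, hδ1]
      obtain ⟨E', hE'⟩ := h.merge hγ hδ (Ne.symm hne) h0.symm (Ne.symm h01) hδ1 (by
        intro ε hε hε0
        rcases h2 γ hγ δ hδ ε hε h0.symm hε0.symm with h' | h' | h'
        exacts [(hne h'.symm).elim, Or.inl h'.symm, Or.inr h'.symm])
      exact absurd (hmin _ _ hE')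
        (not_le.2 (Set.ncard_sdiff_singleton_lt_of_mem (h.source_mem γ hγ) h.finite_vertices))
    refine contractibleSpace_of_arc (h.range_eq_univ hγ ?_) h01 (h.injOn γ hγ) hint0 hint1
    rintro δ hδ (h0 | h0)
    · exact Or.inl (key γ hγ h01 δ hδ h0)
    · exact Or.inr (key _ hrev (by simpa using Ne.symm h01) δ hδ (by simpa using h0))

end IsSymmetricGraphDecomposition

theorem exists_ne_ne_of_pairwise_ne {ι : Type*} {a b c : ι} (hab : a ≠ b) (hac : a ≠ c) (hbc : b ≠ c)
    (i j : ι) : ∃ k, k ≠ i ∧ k ≠ j := by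
  by_contra! hk
  have key : ∀ x y, x ≠ i → y ≠ i → x = y := fun x y hx hy => (hk x hx).trans (hk y hy).symm
  by_cases ha : a = i
  · subst ha
    exact hbc (key b c hab.symm hac.symm)
  by_cases hb : b = i
  · subst hb
    exact hac (key a c hab hbc.symm)
  · exact hab (key a b ha hb)

/-- A nontrivial connected finite graph which is not a circle is contractible or has a branch
point. -/
theorem IsFiniteGraph.contractibleSpace_or_exists_isStar (Y : Type u) [TopologicalSpace Y]
    [hY : IsFiniteGraph Y] [ConnectedSpace Y] [Nontrivial Y] (hC : IsEmpty (Y ≃ₜ Circle)) :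
    ContractibleSpace Y ∨ ∃ (ι : Type u) (_ : Finite ι) (_ : Nonempty ι) (v : Y) (φ : ι → C(I, Y)),
      IsStar v φ ∧ ∀ i j : ι, ∃ k, k ≠ i ∧ k ≠ j := by
  have := hY.t2Space
  have hex : ∃ n, ∃ (V : Set Y) (E : Set C(I, Y)),
      IsSymmetricGraphDecomposition V E ∧ V.ncard = n := by
    obtain ⟨V, E, h⟩ := IsFiniteGraph.exists_isGraphDecomposition Y
    exact ⟨_, V, _, h.symmetrize, rfl⟩
  classical
  obtain ⟨V, E, h, hn⟩ := Nat.find_spec hex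
  have hmin : ∀ V' E', IsSymmetricGraphDecomposition (X := Y) V' E' → V.ncard ≤ V'.ncard :=
    fun V' E' h' => hn ▸ Nat.find_min' hex ⟨V', E', h', rfl⟩
  by_cases h2 : ∀ α ∈ E, ∀ β ∈ E, ∀ γ ∈ E, α 0 = β 0 → α 0 = γ 0 → α = β ∨ α = γ ∨ β = γ
  · rcases h.contractibleSpace_or_circle_of_minimal hmin h2 with h' | ⟨⟨e⟩⟩
    · exact Or.inl h'
    · exact (hC.false e).elim
  · right
    push Not at h2
    obtain ⟨α, hα, β, hβ, γ, hγ, hαβ, hαγ, h12, h13, h23⟩ := h2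
    have := h.finite_edges.to_subtype
    let ι := {δ : C(I, Y) // δ ∈ E ∧ δ 0 = α 0}
    have hfin : Finite ι :=
      Finite.of_injective (fun δ : ι => (⟨δ.1, δ.2.1⟩ : E)) fun a b hab =>
        Subtype.ext (congrArg (fun x : E => x.1) hab)
    refine ⟨ι, hfin, ⟨⟨α, hα, rfl⟩⟩, α 0, _, h.isStar ⟨α, hα, rfl⟩, fun i j => ?_⟩
    let a : ι := ⟨α, hα, rfl⟩
    let b : ι := ⟨β, hβ, hαβ.symm⟩
    let c : ι := ⟨γ, hγ, hαγ.symm⟩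
    have hab : a ≠ b := fun he => h12 (congrArg Subtype.val he)
    have hac : a ≠ c := fun he => h13 (congrArg Subtype.val he)
    have hbc : b ≠ c := fun he => h23 (congrArg Subtype.val he)
    exact exists_ne_ne_of_pairwise_ne hab hac hbc i j

/-! ### Coincidence-free deformations and vanishing of the invariants. -/

namespace IsGraphDecomposition

variable {X : Type*} [TopologicalSpace X] [T2Space X] {V : Set X} {E : Set C(I, X)}

/-- A union of path components of a graph is closed. -/
theorem isClosed_of_joined (h : IsGraphDecomposition V E) {S : Set X}
    (hS : ∀ x y, Joined x y → x ∈ S → y ∈ S) : IsClosed S := by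
  have hγ : ∀ (γ : C(I, X)) (s t : I), Joined (γ s) (γ t) := fun γ s t =>
    ⟨(⟨γ, rfl, rfl⟩ : Path (γ 0) (γ 1)).subpath s t⟩
  -- An arc starting in `S` stays in `S`, so `S` is a finite union of points and compact arcs.
  have hS' : S = (V ∩ S) ∪ ⋃ γ ∈ E ∩ {γ | γ 0 ∈ S}, Set.range γ := by
    ext x
    constructor
    · intro hx
      rcases h.cover x with hV | ⟨γ, hγE, t, -, rfl⟩
      · exact Or.inl ⟨hV, hx⟩
      · exact Or.inr (Set.mem_biUnion ⟨hγE, hS _ _ (hγ γ t 0) hx⟩ ⟨t, rfl⟩)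
    · rintro (hx | hx)
      · exact hx.2
      · simp only [Set.mem_iUnion] at hx
        obtain ⟨γ, ⟨-, h0⟩, t, rfl⟩ := hx
        exact hS _ _ (hγ γ 0 t) h0
  rw [hS']
  exact (h.finite_vertices.subset Set.inter_subset_left).isClosed.union
    ((h.finite_edges.subset Set.inter_subset_left).isClosed_biUnion fun γ _ =>
      (isCompact_range γ.continuous).isClosed)

theorem pathConnectedSpace [ConnectedSpace X] (h : IsGraphDecomposition V E) :
    PathConnectedSpace X := by
  obtain ⟨x⟩ := ConnectedSpace.toNonempty (α := X)
  have h1 : IsClosed (pathComponent x) :=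
    h.isClosed_of_joined fun y z hyz hy => Joined.trans hy hyz
  have h2 : IsClosed (pathComponent x)ᶜ :=
    h.isClosed_of_joined fun y z hyz hy hz => hy (Joined.trans hz hyz.symm)
  have h3 : pathComponent x = Set.univ :=
    IsClopen.eq_univ ⟨h1, isClosed_compl_iff.1 h2⟩ ⟨x, mem_pathComponent_self x⟩
  have hj : ∀ y, Joined x y := fun y => (h3 ▸ Set.mem_univ y : y ∈ pathComponent x)
  exact ⟨⟨x⟩, fun y z => (hj y).symm.trans (hj z)⟩

end IsGraphDecomposition

/-- Maps from a finite graph to a space with a branch point can be made coincidence-free. -/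
theorem IsStar.exists_coin_eq_empty {X Y ι : Type*} [TopologicalSpace X] [TopologicalSpace Y]
    [IsFiniteGraph X] [T2Space Y] [PathConnectedSpace Y] [Finite ι] [Nonempty ι] {v : Y}
    {φ : ι → C(I, Y)} (h : IsStar v φ) (h3 : ∀ i j : ι, ∃ k, k ≠ i ∧ k ≠ j) (f g : C(X, Y)) :
    ∃ f' g' : C(X, Y), f.Homotopic f' ∧ g.Homotopic g' ∧ coin f' g' = ∅ := by
  have := IsFiniteGraph.t2Space (X := X)
  obtain ⟨V, E, hX⟩ := IsFiniteGraph.exists_isGraphDecomposition X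
  obtain ⟨k⟩ := ‹Nonempty ι›
  -- A loop in `Y × Y` is a pair of loops, and it avoids the diagonal when these never meet at the
  -- same time.
  have hloop : ∀ γ : Path (v, φ k 1) (v, φ k 1), ∃ γ' : Path (v, φ k 1) (v, φ k 1),
      γ.Homotopic γ' ∧ ∀ t, γ' t ∈ {z : Y × Y | z.1 ≠ z.2} := by
    intro γ
    obtain ⟨p, q, hp, hq, hpq⟩ := h.coincidenceFree h3 k
      (Path.Homotopic.Quotient.mk (γ.map continuous_fst))
      (Path.Homotopic.Quotient.mk (γ.map continuous_snd))
    obtain ⟨P⟩ := Path.Homotopic.Quotient.exact hp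
    obtain ⟨Q⟩ := Path.Homotopic.Quotient.exact hq
    exact ⟨p.prod q, ⟨(Path.Homotopic.prodHomotopy P Q).symm⟩, hpq⟩
  obtain ⟨F, ⟨H⟩, hF⟩ := hX.exists_homotopic_forall_mem (z₀ := (v, φ k 1))
    (W := {z : Y × Y | z.1 ≠ z.2}) (h.ne_center one_ne_zero).symm hloop (f.prodMk g)
  refine ⟨ContinuousMap.fst.comp F, ContinuousMap.snd.comp F,
    ContinuousMap.Homotopic.comp (.refl ContinuousMap.fst) ⟨H⟩,
    ContinuousMap.Homotopic.comp (.refl ContinuousMap.snd) ⟨H⟩, ?_⟩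
  exact Set.eq_empty_of_forall_notMem fun x hx => hF x hx

/-- Maps to a nontrivial contractible space can be made coincidence-free. -/
theorem exists_coin_eq_empty_of_contractibleSpace {X Y : Type*} [TopologicalSpace X]
    [TopologicalSpace Y] [ContractibleSpace Y] [Nontrivial Y] (f g : C(X, Y)) :
    ∃ f' g' : C(X, Y), f.Homotopic f' ∧ g.Homotopic g' ∧ coin f' g' = ∅ := by
  obtain ⟨a, b, hab⟩ := exists_pair_ne Y
  have key : ∀ (k : C(X, Y)) (y : Y), k.Homotopic (ContinuousMap.const X y) := by
    intro k y
    obtain ⟨z, hz⟩ := id_nullhomotopic Y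
    have h1 : ∀ k : C(X, Y), k.Homotopic (ContinuousMap.const X z) := fun k =>
      ContinuousMap.Homotopic.comp hz (.refl k)
    exact (h1 k).trans (h1 (ContinuousMap.const X y)).symm
  exact ⟨_, _, key f a, key g b, Set.eq_empty_of_forall_notMem fun _ hx => hab hx⟩

/-- Maps of finite graphs can be made coincidence-free if the codomain is connected, nontrivial and
not a circle. -/
theorem exists_coin_eq_empty {X : Type u} {Y : Type v} [TopologicalSpace X] [TopologicalSpace Y]
    [IsFiniteGraph X] [hY : IsFiniteGraph Y] [ConnectedSpace Y] [Nontrivial Y]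
    (hC : IsEmpty (Y ≃ₜ Circle)) (f g : C(X, Y)) :
    ∃ f' g' : C(X, Y), f.Homotopic f' ∧ g.Homotopic g' ∧ coin f' g' = ∅ := by
  have := hY.t2Space
  rcases IsFiniteGraph.contractibleSpace_or_exists_isStar Y hC with
    h | ⟨ι, _, _, v, φ, h, h3⟩
  · exact exists_coin_eq_empty_of_contractibleSpace f g
  · obtain ⟨V, E, hVE⟩ := IsFiniteGraph.exists_isGraphDecomposition Y
    have := hVE.pathConnectedSpace
    exact h.exists_coin_eq_empty h3 f g

end Graph

theorem theorem2 {X : Type u} {Y : Type v}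
    [TopologicalSpace X] [TopologicalSpace Y]
    [IsFiniteGraph X] [ConnectedSpace X]
    [IsFiniteGraph Y] [ConnectedSpace Y] [Nontrivial Y]
    (hY : IsEmpty (Y ≃ₜ Circle)) :
    (∀ f g : C(X, Y), ∃ f' g' : C(X, Y),
      f.Homotopic f' ∧ g.Homotopic g' ∧ coin f' g' = ∅) ∧
    (∀ (A : Type w) [AddCommGroup A] (I : CoincidenceIndex X Y A) (f g : C(X, Y)),
      I.index f g = 0) ∧
    (∀ (N : NielsenCoincidenceNumber X Y) (f g : C(X, Y)), N.number f g = 0) ∧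
    (∀ (A : Type w) [AddCommGroup A] (T : CoincidenceReidemeisterTrace X Y A) (f g : C(X, Y)),
      T.trace f g = 0 ∧ T.essentialNumber f g = 0) := by
  have main := exists_coin_eq_empty (X := X) hY
  refine ⟨main, fun A _ J f g => ?_, fun N f g => ?_, fun A _ T f g => ?_⟩
  all_goals obtain ⟨f', g', hf, hg, hfg⟩ := main f g
  · rw [J.homotopy_invariant f f' g g' hf hg, J.eq_zero_of_coincidenceFree f' g' hfg]
  · have h := N.le_encard_coin f' g'
    rw [hfg, Set.encard_empty] at h
    rw [N.homotopy_invariant f f' g g' hf hg]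
    exact_mod_cast nonpos_iff_eq_zero.1 h
  · obtain ⟨F⟩ := hf
    obtain ⟨G⟩ := hg
    have h : T.trace f g = 0 := by
      -- The reversed homotopies carry the zero trace of the coincidence-free pair back to `(f, g)`.
      rw [← T.homotopy_invariant f' f g' g F.symm G.symm, T.eq_zero_of_coincidenceFree f' g' hfg,
        Finsupp.mapDomain_zero]
    exact ⟨h, by rw [CoincidenceReidemeisterTrace.essentialNumber, h, Finsupp.support_zero,
      Finset.card_empty]⟩
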